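/- Let $G$ be a locally compact (Hausdorff) group. For a closed subgroup $H$ of $G$ let $G/H$ be the space of left cosets, $p_H:G\to G/H$ the quotient map, $A_H=C_0(G/H)$ (complex-valued functions), and let $\varphi_H:A_H\to C_b(G)$ be $f\mapsto f\circ p_H$. For closed subgroups $K\subset H$ let $p_{K,H}:G/K\to G/H$ be the map $gK\mapsto gH$ and let $\varphi_{K,H}:A_H\to C_b(G/K)=M(A_K)$ be $f\mapsto f\circ p_{K,H}$, where $M(\cdot)$ denotes the multiplier algebra and $C_b(G/K)$ acts on $C_0(G/K)$ by pointwise multiplication. If $\mathcal L$ is a meet-semilattice, an $\mathcal L$-graded $C^*$-algebra is a $C^*$-algebra $\mathfrak A$ with a family $(A_i)_{i\in\mathcal L}$ of sub-$C^*$-algebras (the components) which is linearly independent, whose linear span is dense in $\mathfrak A$, and such that $A_iA_j\subset A_{i\wedge j}$ for all $i,j\in\mathcal L$. Its structure morphisms are the homomorphisms $A_j\to M(A_i)$, $i\le j$, which send $y\in A_j$ to the multiplier $x\mapsto yx$, $x\mapsto xy$ of $A_i$. (1) For closed subgroups $H,K$ of $G$ the following conditions are equivalent: (i) $\varphi_{H\cap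 K,H}(A_H)\,\varphi_{H\cap K,K}(A_K)\subset A_{H\cap K}$; (ii) the map $x\mapsto(p_{H\cap K,H}(x),p_{H\cap K,K}(x))$ from $G/(H\cap K)$ to $G/H\times G/K$ is closed; (iii) $HK=\{xy: x\in H,\ y\in K\}$ is closed in $G$ and the product map $H\times K\to HK$ is open; (iv) $p_H(K)$ is closed in $G/H$ and the map $K\to p_H(K)$ obtained by restricting $p_H$ is open; (v) $p_K(H)$ is closed in $G/K$ and the map $H\to p_K(H)$ obtained by restricting $p_K$ is open. Now let $\mathcal L$ be a set of closed subgroups of $G$ that is stable under intersection of two subgroups, ordered by inclusion, and suppose that all $H,K\in\mathcal L$ satisfy the equivalent conditions (i)–(v). (2) There is an $\mathcal L$-graded $C^*$-algebra $\mathfrak A$ whose components are (isomorphic to) the algebras $A_H=C_0(G/H)$, $H\in\mathcal L$, and whose structure morphisms are, under these isomorphisms, the $\varphi_{K,H}$, $K\subset H$. (3) For every such $\mathfrak A$ there is a unique $*$-homomorphism $\varphi:\mathfrak A\to C_b(G)$ whose restriction to the component $A_H$ is $\varphi_H$ for every $H\in\mathcal L$, and $\varphi$ is injective if and only if for all $H,K\in\mathcal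 L$ with $K\subset H$ and $H\neq K$ the quotient space $H/K$ is not compact. -/

import Mathlib

open scoped ZeroAtInfty BoundedContinuousFunction MultiplierAlgebra Pointwise

universe u v

/-- A sub-semilattice of a meet-semilattice: a subset (possibly empty) stable under `⊓`. -/
structure SubSemilattice (α : Type u) [SemilatticeInf α] where
  carrier : Set α
  inf_mem : ∀ a ∈ carrier, ∀ b ∈ carrier, a ⊓ b ∈ carrier

instance SubSemilattice.instCoeSort (α : Type u) [SemilatticeInf α] :
    CoeSort (SubSemilattice α) (Type u) :=
  ⟨fun S => {a : α // a ∈ S.carrier}⟩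

/-- With the induced order and the induced meet, a sub-semilattice is a semilattice. -/
instance SubSemilattice.instSemilatticeInf {α : Type u} [SemilatticeInf α]
    (S : SubSemilattice α) : SemilatticeInf S :=
  Subtype.semilatticeInf fun {a b} ha hb => S.inf_mem a ha b hb

section Graded

/-- `(𝔄, (A i))` is a C⋆-algebra graded by the semilattice `ι`: the `A i` are sub-C⋆-algebras of
the C⋆-algebra `𝔄`, they are linearly independent (in direct sum), total (their union spans a dense
subspace), and `A i * A j ⊆ A (i ⊓ j)`. -/
structure IsGradedCStarAlgebra {ι : Type u} [SemilatticeInf ι] {𝔄 : Type v}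
    [NonUnitalCStarAlgebra 𝔄] (A : ι → NonUnitalStarSubalgebra ℂ 𝔄) : Prop where
  isClosed : ∀ i, IsClosed (A i : Set 𝔄)
  independent : iSupIndep fun i => (A i).toSubmodule
  total : Dense ((Submodule.span ℂ (⋃ i, (A i : Set 𝔄)) : Submodule ℂ 𝔄) : Set 𝔄)
  mul_mem : ∀ i j, ∀ x ∈ A i, ∀ y ∈ A j, x * y ∈ A (i ⊓ j)

variable {ι : Type u} [SemilatticeInf ι] {𝔄 : Type v} [NonUnitalCStarAlgebra 𝔄]
  {A : ι → NonUnitalStarSubalgebra ℂ 𝔄}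

theorem IsGradedCStarAlgebra.mul_mem_left (hA : IsGradedCStarAlgebra A) {i j : ι} (hij : i ≤ j)
    {x y : 𝔄} (hx : x ∈ A i) (hy : y ∈ A j) : y * x ∈ A i := by
  have h := hA.mul_mem j i y hy x hx
  rwa [inf_eq_right.2 hij] at h

theorem IsGradedCStarAlgebra.mul_mem_right (hA : IsGradedCStarAlgebra A) {i j : ι} (hij : i ≤ j)
    {x y : 𝔄} (hx : x ∈ A i) (hy : y ∈ A j) : x * y ∈ A i := by
  have h := hA.mul_mem i j x hx y hy
  rwa [inf_eq_left.2 hij] at h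

/-- The structure morphism `φ i j : A j → M(A i)` (for `i ≤ j`) of a graded C⋆-algebra: the
element `y` of `A j` acts on `A i` by `x ↦ y * x` and `x ↦ x * y`. -/
noncomputable def IsGradedCStarAlgebra.structureMorphism (hA : IsGradedCStarAlgebra A) {i j : ι}
    (hij : i ≤ j) (y : A j) : 𝓜(ℂ, A i) where
  fst := LinearMap.mkContinuous
    { toFun := fun x => ⟨(y : 𝔄) * (x : 𝔄), hA.mul_mem_left hij x.2 y.2⟩
      map_add' := fun a b => Subtype.ext (mul_add (y : 𝔄) (a : 𝔄) (b : 𝔄))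
      map_smul' := fun c a => Subtype.ext (mul_smul_comm c (y : 𝔄) (a : 𝔄)) }
    ‖(y : 𝔄)‖ (fun x => norm_mul_le (y : 𝔄) (x : 𝔄))
  snd := LinearMap.mkContinuous
    { toFun := fun x => ⟨(x : 𝔄) * (y : 𝔄), hA.mul_mem_right hij x.2 y.2⟩
      map_add' := fun a b => Subtype.ext (add_mul (a : 𝔄) (b : 𝔄) (y : 𝔄))
      map_smul' := fun c a => Subtype.ext (smul_mul_assoc c (a : 𝔄) (y : 𝔄)) }
    ‖(y : 𝔄)‖ (fun x => (norm_mul_le (x : 𝔄) (y : 𝔄)).trans_eq (mul_comm _ _))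
  central := fun a b => Subtype.ext (mul_assoc (a : 𝔄) (y : 𝔄) (b : 𝔄))

end Graded

section Multiplier

variable {X : Type u} [TopologicalSpace X]

/-- The product `u * f ∈ C₀(X)` of `u ∈ C_b(X)` and `f ∈ C₀(X)`. -/
noncomputable def boundedMulZeroAtInfty (u : X →ᵇ ℂ) (f : C₀(X, ℂ)) : C₀(X, ℂ) where
  toFun := fun x => u x * f x
  continuous_toFun := u.continuous.mul f.continuous
  zero_at_infty' := by
    refine Filter.Tendsto.zero_mul_isBoundedUnder_le f.zero_at_infty' ?_ |>.congr
      fun x => mul_comm _ _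
    exact Filter.isBoundedUnder_of ⟨‖u‖, fun x => u.norm_coe_le_norm x⟩

theorem norm_boundedMulZeroAtInfty_le (u : X →ᵇ ℂ) (f : C₀(X, ℂ)) :
    ‖boundedMulZeroAtInfty u f‖ ≤ ‖u‖ * ‖f‖ := by
  rw [← ZeroAtInftyContinuousMap.norm_toBCF_eq_norm, ← ZeroAtInftyContinuousMap.norm_toBCF_eq_norm]
  exact norm_mul_le u f.toBCF

/-- The identification `C_b(X) → M(C₀(X))`: a bounded continuous function acts on `C₀(X)` by
pointwise multiplication. -/
noncomputable def boundedToMultiplier (u : X →ᵇ ℂ) : 𝓜(ℂ, C₀(X, ℂ)) where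
  fst := LinearMap.mkContinuous
    { toFun := boundedMulZeroAtInfty u
      map_add' := fun f g => ZeroAtInftyContinuousMap.ext fun x => mul_add (u x) (f x) (g x)
      map_smul' := fun c f => ZeroAtInftyContinuousMap.ext fun x => mul_smul_comm c (u x) (f x) }
    ‖u‖ (norm_boundedMulZeroAtInfty_le u)
  snd := LinearMap.mkContinuous
    { toFun := boundedMulZeroAtInfty u
      map_add' := fun f g => ZeroAtInftyContinuousMap.ext fun x => mul_add (u x) (f x) (g x)
      map_smul' := fun c f => ZeroAtInftyContinuousMap.ext fun x => mul_smul_comm c (u x) (f x) }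
    ‖u‖ (norm_boundedMulZeroAtInfty_le u)
  central := fun f g => ZeroAtInftyContinuousMap.ext fun x => by
    change u x * f x * g x = f x * (u x * g x)
    ring

end Multiplier

section Cosets

variable {G : Type u} [Group G] [TopologicalSpace G]

/-- The continuous map `p_{K,H} : G ⧸ K → G ⧸ H`, `g K ↦ g H`, for `K ≤ H`. -/
def cosetProjection {K H : Subgroup G} (h : K ≤ H) : C(G ⧸ K, G ⧸ H) where
  toFun := Subgroup.quotientMapOfLE h
  continuous_toFun := continuous_id.quotient_map' _

/-- The homomorphism `φ_{K,H} : C₀(G ⧸ H) → C_b(G ⧸ K)`, `f ↦ f ∘ p_{K,H}`, for `K ≤ H`. -/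
noncomputable def cosetPullback {K H : Subgroup G} (h : K ≤ H) (f : C₀(G ⧸ H, ℂ)) :
    (G ⧸ K) →ᵇ ℂ :=
  f.toBCF.compContinuous (cosetProjection h)

/-- The embedding `φ_H : C₀(G ⧸ H) → C_b(G)`, `f ↦ f ∘ p_H`, where `p_H : G → G ⧸ H` is the
quotient map. -/
noncomputable def groupPullback (H : Subgroup G) (f : C₀(G ⧸ H, ℂ)) : G →ᵇ ℂ :=
  f.toBCF.compContinuous ⟨fun g : G => (g : G ⧸ H), continuous_quotient_mk'⟩

/-- The product set `HK` is closed in `G`, and the product map `H × K → HK` is open, where `HK`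
carries the subspace topology. -/
def ClosedOpenProduct (H K : Subgroup G) : Prop :=
  IsClosed ((H : Set G) * (K : Set G)) ∧
    IsOpenMap fun x : H × K =>
      (⟨(x.1 : G) * (x.2 : G), Set.mul_mem_mul x.1.2 x.2.2⟩ :
        ((H : Set G) * (K : Set G) : Set G))

/-- The image of `K` in `G ⧸ H` is closed, and the map from `K` onto this image is open. -/
def ClosedOpenImage (H K : Subgroup G) : Prop :=
  IsClosed ((fun g : G => (g : G ⧸ H)) '' (K : Set G)) ∧
    IsOpenMap ((K : Set G).imageFactorization fun g : G => (g : G ⧸ H))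

/-- A structure on `𝔄` of C⋆-algebra graded by the semilattice `ℒ` of closed subgroups, with
components `A_H = C₀(G ⧸ H)` (through isomorphisms `iso H`) and with structure morphisms
`φ_{K,H} : C₀(G ⧸ H) → C_b(G ⧸ K) = M(C₀(G ⧸ K))` for `K ≤ H`. The last two fields say that, under
these isomorphisms, the multiplier of `A_K` which the structure morphism associates with
`f ∈ C₀(G ⧸ H)` is the multiplier of `C₀(G ⧸ K)` given by `φ_{K,H}(f)`. -/
structure CosetGrading (ℒ : SubSemilattice (ClosedSubgroup G)) (𝔄 : Type v)
    [NonUnitalCStarAlgebra 𝔄] where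
  component : ℒ → NonUnitalStarSubalgebra ℂ 𝔄
  isGraded : IsGradedCStarAlgebra component
  iso : ∀ H : ℒ, C₀(G ⧸ H.1.toSubgroup, ℂ) ≃⋆ₐ[ℂ] component H
  structureMorphism_fst : ∀ (K H : ℒ) (h : K ≤ H) (f : C₀(G ⧸ H.1.toSubgroup, ℂ))
    (g : C₀(G ⧸ K.1.toSubgroup, ℂ)),
    (isGraded.structureMorphism h (iso H f)).fst (iso K g) =
      iso K ((boundedToMultiplier (cosetPullback (K := K.1.toSubgroup) (H := H.1.toSubgroup)
        h f)).fst g)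
  structureMorphism_snd : ∀ (K H : ℒ) (h : K ≤ H) (f : C₀(G ⧸ H.1.toSubgroup, ℂ))
    (g : C₀(G ⧸ K.1.toSubgroup, ℂ)),
    (isGraded.structureMorphism h (iso H f)).snd (iso K g) =
      iso K ((boundedToMultiplier (cosetPullback (K := K.1.toSubgroup) (H := H.1.toSubgroup)
        h f)).snd g)

/-- `φ : 𝔄 → C_b(G)` is the natural homomorphism: it restricts to `f ↦ f ∘ p_H` on the component
`C₀(G ⧸ H)`, for every `H` in `ℒ`. -/
def CosetGrading.IsNatural {ℒ : SubSemilattice (ClosedSubgroup G)} {𝔄 : Type v}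
    [NonUnitalCStarAlgebra 𝔄] (S : CosetGrading ℒ 𝔄) (φ : 𝔄 →⋆ₙₐ[ℂ] (G →ᵇ ℂ)) : Prop :=
  ∀ (H : ℒ) (f : C₀(G ⧸ H.1.toSubgroup, ℂ)),
    φ (S.iso H f : 𝔄) = groupPullback H.1.toSubgroup f

end Cosets

/-! Conditions on a pair. The diagonal map from `G ⧸ (H ⊓ K)` to `G ⧸ H × G ⧸ K` is continuous and
injective, so it is closed exactly when it is proper. Properness is what makes the products of
pullbacks vanish at infinity; conversely, functions equal to 1 on compact sets detect it. Slicing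
the diagonal at the base point of `G ⧸ K` gives the condition on the image of `K`. Lifting along `G
→ G ⧸ H` gives the condition on the product set, and an approximation argument returns from there to
closedness. Inversion exchanges the two subgroups.

Existence. All the algebras embed in `C_b` of a disjoint union of copies of `G`, one sheet for each
`K` in the semilattice: `f ∈ C₀(G ⧸ H)` lives on the sheets `K ≤ H`. Independence is read on the
sheet of a maximal index, and the algebra is the closed span.

Natural homomorphism. A finite sum of elements of components above `K` acts on `A_K` as a bounded
function. Testing against a function equal to 1 at one point shows that the map to `C_b(G)` is
contractive on finite sums.

Injectivity. If `H ⧸ K` is compact, pullback sends `C₀(G ⧸ H)` into `C₀(G ⧸ K)`, which contradicts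
independence. Otherwise `‖x‖ ≤ ‖φ x‖` is proved with characters, the algebra being commutative. The
components on which a character is nonzero form a filter, so on a finite sum it sees only the terms
above some `K` (`norm_character_sum_le`). These are isolated by translating by elements of `K` that
make the other terms small (`norm_sum_filter_le_of_not_compactSpace`). Such elements exist by a
topological Neumann covering lemma. -/

open Topology in
theorem isOpenMap_mk_mem_iff {α β : Type*} [TopologicalSpace α] [TopologicalSpace β] {S : Set β}
    {f : α → β} (hf : ∀ a, f a ∈ S) :
    IsOpenMap (fun a => (⟨f a, hf a⟩ : S)) ↔
      ∀ a, ∀ U ∈ 𝓝 a, ∃ V ∈ 𝓝 (f a), V ∩ S ⊆ f '' U := by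
  rw [isOpenMap_iff_nhds_le]
  refine forall_congr' fun a => ⟨fun h U hU => ?_, fun h N hN => ?_⟩
  · have := h (Filter.image_mem_map hU)
    rw [nhds_subtype_eq_comap, Filter.mem_comap] at this
    obtain ⟨V, hV, hVU⟩ := this
    refine ⟨V, hV, fun y hy => ?_⟩
    obtain ⟨x, hx, hxy⟩ := hVU (show (⟨y, hy.2⟩ : S) ∈ Subtype.val ⁻¹' V from hy.1)
    exact ⟨x, hx, congrArg Subtype.val hxy⟩
  · obtain ⟨V, hV, hVU⟩ := h _ hN
    rw [nhds_subtype_eq_comap, Filter.mem_comap]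
    refine ⟨V, hV, fun y hy => ?_⟩
    obtain ⟨x, hx, hxy⟩ := hVU ⟨hy, y.2⟩
    have hx' : (⟨f x, hf x⟩ : S) ∈ N := hx
    rwa [show (⟨f x, hf x⟩ : S) = y from Subtype.ext hxy] at hx'

/-! ### Topological conditions on a pair of subgroups -/

section Cosets

variable {G : Type u} [Group G] [TopologicalSpace G]

open Topology in
theorem closedOpenProduct_iff {H K : Subgroup G} :
    ClosedOpenProduct H K ↔ IsClosed ((H : Set G) * (K : Set G)) ∧
      ∀ h ∈ H, ∀ k ∈ K, ∀ U ∈ 𝓝 h, ∀ V ∈ 𝓝 k, ∃ W ∈ 𝓝 (h * k),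
        ∀ x ∈ W, x ∈ (H : Set G) * (K : Set G) →
          ∃ h' ∈ H, ∃ k' ∈ K, h' ∈ U ∧ k' ∈ V ∧ h' * k' = x := by
  rw [ClosedOpenProduct, isOpenMap_mk_mem_iff (f := fun x : H × K => (x.1 : G) * (x.2 : G))]
  refine and_congr_right fun _ => ⟨fun H1 h hh k hk U hU V hV => ?_, fun H1 => ?_⟩
  · obtain ⟨W, hW, hW'⟩ := H1 (⟨h, hh⟩, ⟨k, hk⟩) ((Subtype.val ⁻¹' U) ×ˢ (Subtype.val ⁻¹' V))
      (prod_mem_nhds (continuous_subtype_val.continuousAt.preimage_mem_nhds hU)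
        (continuous_subtype_val.continuousAt.preimage_mem_nhds hV))
    refine ⟨W, hW, fun x hx hx' => ?_⟩
    obtain ⟨⟨a, b⟩, ⟨ha, hb⟩, rfl⟩ := hW' ⟨hx, hx'⟩
    exact ⟨a, a.2, b, b.2, ha, hb, rfl⟩
  · rintro ⟨⟨h, hh⟩, ⟨k, hk⟩⟩ N hN
    rw [nhds_prod_eq, Filter.mem_prod_iff] at hN
    obtain ⟨U', hU', V', hV', hN⟩ := hN
    rw [nhds_subtype_eq_comap, Filter.mem_comap] at hU' hV'
    obtain ⟨U, hU, hUU⟩ := hU'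
    obtain ⟨V, hV, hVV⟩ := hV'
    obtain ⟨W, hW, hW'⟩ := H1 h hh k hk U hU V hV
    refine ⟨W, hW, fun x hx => ?_⟩
    obtain ⟨h', hh', k', hk', h1, h2, rfl⟩ := hW' x hx.1 hx.2
    exact ⟨(⟨h', hh'⟩, ⟨k', hk'⟩), hN ⟨hUU h1, hVV h2⟩, rfl⟩

/-- The map `G ⧸ (H ⊓ K) → G ⧸ H × G ⧸ K`. -/
def cosetDiagonal (H K : Subgroup G) (x : G ⧸ (H ⊓ K)) : (G ⧸ H) × (G ⧸ K) :=
  (cosetProjection (inf_le_left : H ⊓ K ≤ H) x, cosetProjection (inf_le_right : H ⊓ K ≤ K) x)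

theorem cosetDiagonal_mk (H K : Subgroup G) (g : G) :
    cosetDiagonal H K (g : G ⧸ (H ⊓ K)) = ((g : G ⧸ H), (g : G ⧸ K)) := rfl

theorem continuous_cosetDiagonal (H K : Subgroup G) : Continuous (cosetDiagonal H K) :=
  (cosetProjection _).continuous.prodMk (cosetProjection _).continuous

theorem cosetDiagonal_injective (H K : Subgroup G) : Function.Injective (cosetDiagonal H K) := by
  intro x y
  induction x using QuotientGroup.induction_on with | H x => ?_
  induction y using QuotientGroup.induction_on with | H y => ?_
  rw [cosetDiagonal_mk, cosetDiagonal_mk, Prod.mk.injEq, QuotientGroup.eq, QuotientGroup.eq,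
    QuotientGroup.eq, Subgroup.mem_inf]
  exact id

variable [IsTopologicalGroup G]

open Topology in
theorem inv_mem_nhds_inv' {g : G} {U : Set G} (hU : U ∈ 𝓝 g) : U⁻¹ ∈ 𝓝 g⁻¹ :=
  continuous_inv.continuousAt.preimage_mem_nhds (by rwa [inv_inv])

open Topology in
theorem ClosedOpenProduct.symm {H K : Subgroup G} (h : ClosedOpenProduct H K) :
    ClosedOpenProduct K H := by
  rw [closedOpenProduct_iff] at h ⊢
  have key : (K : Set G) * (H : Set G) = ((H : Set G) * (K : Set G))⁻¹ := by
    rw [mul_inv_rev, inv_coe_set, inv_coe_set]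
  refine ⟨by rw [key]; exact h.1.inv, fun k hk x hx U hU V hV => ?_⟩
  obtain ⟨W, hW, hW'⟩ := h.2 x⁻¹ (inv_mem hx) k⁻¹ (inv_mem hk) V⁻¹ (inv_mem_nhds_inv' hV)
    U⁻¹ (inv_mem_nhds_inv' hU)
  refine ⟨W⁻¹, by simpa using inv_mem_nhds_inv' hW, fun y hy hy' => ?_⟩
  rw [key] at hy'
  obtain ⟨h', hh', k', hk', h1, h2, h3⟩ := hW' y⁻¹ hy hy'
  exact ⟨k'⁻¹, inv_mem hk', h'⁻¹, inv_mem hh', h2, h1, by rw [← mul_inv_rev, h3, inv_inv]⟩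

open Topology in
theorem ClosedOpenImage.closedOpenProduct {H K : Subgroup G} (h : ClosedOpenImage H K) :
    ClosedOpenProduct H K := by
  refine ClosedOpenProduct.symm ?_
  rw [closedOpenProduct_iff]
  obtain ⟨hc, ho⟩ := h
  constructor
  · rw [← QuotientGroup.preimage_image_mk_eq_mul]
    exact hc.preimage QuotientGroup.continuous_mk
  · intro k0 hk0 h0 hh0 A hA B hB
    -- The factor in `H` will be recovered as `k'⁻¹ * x`; the neighbourhoods `A'` and `C` keep it
    -- inside `B`.
    have hcont : Filter.Tendsto (fun p : G × G => p.1⁻¹ * p.2) (𝓝 (k0, k0 * h0)) (𝓝 h0) := by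
      have : Continuous (fun p : G × G => p.1⁻¹ * p.2) := by fun_prop
      simpa using this.tendsto (k0, k0 * h0)
    have h1 := hcont hB
    rw [nhds_prod_eq, Filter.mem_map, Filter.mem_prod_iff] at h1
    obtain ⟨A', hA', C, hC, hAC⟩ := h1
    have ho' := (isOpenMap_mk_mem_iff (f := fun k : K => ((k : G) : G ⧸ H))
      (fun k => Set.mem_image_of_mem (fun g : G => (g : G ⧸ H)) k.2)).1 ho ⟨k0, hk0⟩
      (Subtype.val ⁻¹' (A ∩ A'))
      (continuous_subtype_val.continuousAt.preimage_mem_nhds (Filter.inter_mem hA hA'))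
    obtain ⟨O, hO, hO'⟩ := ho'
    refine ⟨C ∩ (fun g : G => (g : G ⧸ H)) ⁻¹' O, Filter.inter_mem hC ?_, ?_⟩
    · apply QuotientGroup.continuous_mk.continuousAt.preimage_mem_nhds
      rwa [QuotientGroup.mk_mul_of_mem _ hh0]
    · rintro _ ⟨hxC, hxO⟩ ⟨k, hk, x, hx, rfl⟩
      have hx2 : ((k * x : G) : G ⧸ H) = (k : G ⧸ H) := QuotientGroup.mk_mul_of_mem _ hx
      simp only [Set.mem_preimage] at hxO
      rw [hx2] at hxO
      obtain ⟨⟨k', hk'⟩, ⟨hk'A, hk'A'⟩, hkk⟩ := hO' ⟨hxO, Set.mem_image_of_mem _ hk⟩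
      refine ⟨k', hk', k'⁻¹ * (k * x), ?_, hk'A, hAC (Set.mk_mem_prod hk'A' hxC), by group⟩
      rw [← mul_assoc]
      exact mul_mem (QuotientGroup.eq.1 hkk) hx

-- Closedness of `HK` gives a limit point `(aH, bK)` a common representative `c`. Openness at `(1,
-- 1)` then lets the approximating points of `D` be moved, within their cosets of `H ⊓ K`, close to
-- `c`.
open Topology in
theorem ClosedOpenProduct.isClosedMap_cosetDiagonal {H K : Subgroup G}
    (hHK : ClosedOpenProduct H K) :
    IsClosedMap (cosetDiagonal H K) := by
  rw [closedOpenProduct_iff] at hHK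
  obtain ⟨hcl, hop⟩ := hHK
  intro C hC
  set D : Set G := (fun g : G => (g : G ⧸ (H ⊓ K))) ⁻¹' C with hD
  have hDc : IsClosed D := hC.preimage QuotientGroup.continuous_mk
  refine isClosed_of_closure_subset ?_
  rintro ⟨y, z⟩ hyz
  obtain ⟨a, rfl⟩ := QuotientGroup.mk_surjective y
  obtain ⟨b, rfl⟩ := QuotientGroup.mk_surjective z
  -- The quotient maps are open, so points near `(aH, bK)` have representatives near `(a, b)`.
  have approx : ∀ a b : G, ((a : G ⧸ H), (b : G ⧸ K)) ∈ closure (cosetDiagonal H K '' C) →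
      ∀ N ∈ 𝓝 (a, b), ∃ x ∈ D, ∃ a' b', (a', b') ∈ N ∧ a'⁻¹ * x ∈ H ∧ x⁻¹ * b' ∈ K := by
    intro a b hab N hN
    rw [nhds_prod_eq, Filter.mem_prod_iff] at hN
    obtain ⟨A, hA, B, hB, hN⟩ := hN
    rw [mem_closure_iff_nhds] at hab
    obtain ⟨_, ⟨⟨a', ha', h1⟩, b', hb', h2⟩, x, hx, rfl⟩ := hab _ (prod_mem_nhds
      (QuotientGroup.isOpenMap_coe.image_mem_nhds hA)
      (QuotientGroup.isOpenMap_coe.image_mem_nhds hB))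
    induction x using QuotientGroup.induction_on with | H x => ?_
    rw [cosetDiagonal_mk] at h1 h2
    refine ⟨x, hx, a', b', hN ⟨ha', hb'⟩, QuotientGroup.eq.1 h1, QuotientGroup.eq.1 h2.symm⟩
  have hmem : a⁻¹ * b ∈ (H : Set G) * (K : Set G) := by
    rw [← hcl.closure_eq, mem_closure_iff_nhds]
    intro N hN
    have hc : Continuous (fun p : G × G => p.1⁻¹ * p.2) := by fun_prop
    obtain ⟨x, -, a', b', hN', h1, h2⟩ := approx a b hyz _ (hc.continuousAt.preimage_mem_nhds hN)
    exact ⟨a'⁻¹ * b', hN', _, h1, _, h2, by simp only []; group⟩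
  obtain ⟨h, hh, k, hk, hab⟩ := hmem
  simp only [] at hab
  have ha : (a : G ⧸ H) = ((a * h : G) : G ⧸ H) := (QuotientGroup.mk_mul_of_mem _ hh).symm
  have hb : (b : G ⧸ K) = ((a * h : G) : G ⧸ K) := by
    rw [QuotientGroup.eq, show b⁻¹ * (a * h) = k⁻¹ by
      rw [eq_inv_iff_mul_eq_one, mul_assoc, mul_assoc, hab]; group]
    exact inv_mem hk
  rw [ha, hb] at hyz ⊢
  generalize a * h = c at hyz
  refine ⟨(c : G ⧸ (H ⊓ K)), ?_, rfl⟩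
  change c ∈ D
  rw [← hDc.closure_eq, mem_closure_iff_nhds]
  intro W0 hW0
  have hc : Filter.Tendsto (fun p : G × G => p.1 * p.2) (𝓝 (c, 1)) (𝓝 c) := by
    have : Continuous (fun p : G × G => p.1 * p.2) := by fun_prop
    simpa using this.tendsto (c, 1)
  have h1 := hc hW0
  rw [nhds_prod_eq, Filter.mem_map, Filter.mem_prod_iff] at h1
  obtain ⟨A, hA, W, hW, hAW⟩ := h1
  obtain ⟨N, hN, hN'⟩ := hop 1 (one_mem _) 1 (one_mem _) W hW Set.univ Filter.univ_mem
  rw [one_mul] at hN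
  have hc2 : Filter.Tendsto (fun p : G × G => p.1⁻¹ * p.2) (𝓝 (c, c)) (𝓝 1) := by
    have : Continuous (fun p : G × G => p.1⁻¹ * p.2) := by fun_prop
    simpa using this.tendsto (c, c)
  obtain ⟨x, hx, a', b', ⟨hab', ha'⟩, hxa, hxb⟩ := approx c c hyz _
    (Filter.inter_mem (hc2 hN) (continuous_fst.continuousAt.preimage_mem_nhds hA))
  obtain ⟨h1, hh1, k1, hk1, hW1, -, he⟩ := hN' _ hab' ⟨_, hxa, _, hxb, by simp only []; group⟩
  refine ⟨a' * h1, hAW (Set.mk_mem_prod ha' hW1), ?_⟩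
  -- The two factorizations of `a'⁻¹ * b'` show that `a' * h1` and `x` share a coset of `H ⊓ K`; `D`
  -- is saturated.
  have hl : x⁻¹ * (a' * h1) ∈ H ⊓ K := by
    constructor
    · rw [show x⁻¹ * (a' * h1) = (a'⁻¹ * x)⁻¹ * h1 by group]
      exact H.mul_mem (H.inv_mem hxa) hh1
    · rw [show x⁻¹ * (a' * h1) = (x⁻¹ * b') * k1⁻¹ by
        rw [eq_mul_inv_iff_mul_eq, mul_assoc, mul_assoc, he]; group]
      exact K.mul_mem hxb (K.inv_mem hk1)
  change ((a' * h1 : G) : G ⧸ (H ⊓ K)) ∈ C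
  rwa [← show (x : G ⧸ (H ⊓ K)) = ((a' * h1 : G) : G ⧸ (H ⊓ K)) from QuotientGroup.eq.2 hl]

/-- For closed `C ⊆ K` stable under right multiplication by `H ⊓ K`, the image of `C` in `G ⧸ H` is
the slice of a closed set over the base point of `G ⧸ K`. Openness follows by applying this to the
complement in `K` of a saturated open set. -/
theorem closedOpenImage_of_isClosedMap_cosetDiagonal {H K : Subgroup G} (hK : IsClosed (K : Set G))
    (h : IsClosedMap (cosetDiagonal H K)) : ClosedOpenImage H K := by
  have key : ∀ C : Set G, IsClosed C → C * ((H ⊓ K : Subgroup G) : Set G) ⊆ C → C ⊆ K →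
      IsClosed ((fun g : G => (g : G ⧸ H)) '' C) := by
    intro C hC hCs hCK
    have h1 : IsClosed ((fun g : G => (g : G ⧸ (H ⊓ K))) '' C) := by
      rw [← (QuotientGroup.isQuotientMap_mk _).isClosed_preimage]
      erw [QuotientGroup.preimage_image_mk_eq_mul]
      rwa [hCs.antisymm (Set.subset_mul_left _ (one_mem _))]
    have h2 := (h _ h1).preimage (f := fun x : G ⧸ H => (x, ((1 : G) : G ⧸ K))) (by fun_prop)
    convert! h2 using 1
    ext x
    constructor
    · rintro ⟨c, hc, rfl⟩
      refine ⟨_, ⟨c, hc, rfl⟩, ?_⟩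
      rw [cosetDiagonal_mk, Prod.mk.injEq]
      exact ⟨rfl, (QuotientGroup.eq.2 (by simpa using hCK hc)).symm⟩
    · rintro ⟨_, ⟨c, hc, rfl⟩, hx⟩
      rw [cosetDiagonal_mk, Prod.mk.injEq] at hx
      exact ⟨c, hc, hx.1⟩
  refine ⟨key _ hK ?_ le_rfl, ?_⟩
  · rintro _ ⟨k, hk, l, hl, rfl⟩
    exact mul_mem hk hl.2
  · intro U hU
    obtain ⟨V, hV, rfl⟩ := isOpen_induced_iff.1 hU
    have hcl := key ((K : Set G) \ (V * ((H ⊓ K : Subgroup G) : Set G)))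
      (hK.sdiff hV.mul_right) ?_ Set.sdiff_subset
    · rw [isOpen_induced_iff]
      refine ⟨_, hcl.isOpen_compl, Set.ext ?_⟩
      rintro ⟨_, k, hk, rfl⟩
      constructor
      · intro hmem
        have hkV : k ∈ V * ((H ⊓ K : Subgroup G) : Set G) := by
          by_contra hkV
          exact hmem ⟨k, ⟨hk, hkV⟩, rfl⟩
        obtain ⟨v, hv, l, hl, rfl⟩ := hkV
        have hvK : v ∈ K := (K.mul_mem_cancel_right hl.2).1 hk
        exact ⟨⟨v, hvK⟩, hv, Subtype.ext (QuotientGroup.mk_mul_of_mem v hl.1).symm⟩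
      · rintro ⟨⟨v, hvK⟩, hv, hvk⟩ ⟨c, ⟨hcK, hcV⟩, hck⟩
        have hvc : (v : G ⧸ H) = (c : G ⧸ H) := (congrArg Subtype.val hvk).trans hck.symm
        exact hcV ⟨v, hv, v⁻¹ * c, ⟨QuotientGroup.eq.1 hvc, K.mul_mem (K.inv_mem hvK) hcK⟩,
          mul_inv_cancel_left v c⟩
    · rintro _ ⟨k, ⟨hk, hkV⟩, l, hl, rfl⟩
      refine ⟨mul_mem hk hl.2, ?_⟩
      rintro ⟨v, hv, m, hm, hvm⟩
      exact hkV ⟨v, hv, m * l⁻¹, mul_mem hm (inv_mem hl), by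
        simp only [] at hvm ⊢
        rw [← mul_assoc, hvm, mul_inv_cancel_right]⟩

end Cosets

/-! ### Vanishing at infinity, properness and the equivalence -/

theorem exists_zeroAtInfty_eq_one {X : Type*} [TopologicalSpace X] [T2Space X]
    [LocallyCompactSpace X] {C : Set X} (hC : IsCompact C) :
    ∃ f : C₀(X, ℂ), (∀ x ∈ C, f x = 1) ∧ (∀ x, ‖f x‖ ≤ 1) ∧ ∀ x, ‖1 - f x‖ ≤ 1 := by
  obtain ⟨f, hf1, -, hfc, hf⟩ :=
    exists_continuous_one_zero_of_isCompact hC isClosed_empty (Set.disjoint_empty C)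
  refine ⟨⟨⟨fun x => (f x : ℂ), by fun_prop⟩, ?_⟩, fun x hx => ?_, fun x => ?_, fun x => ?_⟩
  · have := (Complex.continuous_ofReal.tendsto' 0 0 Complex.ofReal_zero).comp hfc.is_zero_at_infty
    exact this
  · simpa using congrArg (fun t : ℝ => (t : ℂ)) (hf1 hx)
  · change ‖((f x : ℝ) : ℂ)‖ ≤ 1
    rw [Complex.norm_real, Real.norm_eq_abs, abs_le]
    constructor <;> linarith [(hf x).1, (hf x).2]
  · change ‖1 - ((f x : ℝ) : ℂ)‖ ≤ 1
    rw [← Complex.ofReal_one, ← Complex.ofReal_sub, Complex.norm_real, Real.norm_eq_abs, abs_le]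
    constructor <;> linarith [(hf x).1, (hf x).2]

theorem tendsto_mul_cocompact_prod {X Y : Type*} [TopologicalSpace X] [TopologicalSpace Y]
    (f : C₀(X, ℂ)) (g : C₀(Y, ℂ)) :
    Filter.Tendsto (fun p : X × Y => f p.1 * g p.2) (Filter.cocompact (X × Y)) (nhds 0) := by
  rw [← Filter.coprod_cocompact, Filter.coprod, Filter.tendsto_sup]
  constructor
  · exact (f.zero_at_infty'.comp Filter.tendsto_comap).zero_mul_isBoundedUnder_le
      (Filter.isBoundedUnder_of ⟨‖g.toBCF‖, fun p => g.toBCF.norm_coe_le_norm p.2⟩)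
  · exact Filter.isBoundedUnder_le_mul_tendsto_zero
      (Filter.isBoundedUnder_of ⟨‖f.toBCF‖, fun p => f.toBCF.norm_coe_le_norm p.1⟩)
      (g.zero_at_infty'.comp Filter.tendsto_comap)

instance ClosedSubgroup.instIsClosed {G : Type u} [Group G] [TopologicalSpace G]
    (H : ClosedSubgroup G) : IsClosed (H.toSubgroup : Set G) := H.isClosed'

section Cosets

variable {G : Type u} [Group G] [TopologicalSpace G]

theorem compactSpace_quotient_of_subset_mul {H K : Subgroup G} [hH : IsClosed (H : Set G)]
    (hKH : K ≤ H) {T : Set G} (hT : IsCompact T) (h : (H : Set G) ⊆ T * (K : Set G)) :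
    CompactSpace (H ⧸ K.subgroupOf H) := by
  have hc : IsCompact ((↑) ⁻¹' T : Set H) := hH.isClosedEmbedding_subtypeVal.isCompact_preimage hT
  refine ⟨?_⟩
  convert! hc.image (QuotientGroup.continuous_mk (N := K.subgroupOf H))
  symm
  rw [Set.eq_univ_iff_forall]
  intro x
  induction x using QuotientGroup.induction_on with | H x => ?_
  obtain ⟨t, ht, k, hk, htk⟩ := h x.2
  simp only [] at htk
  have htH : t ∈ H := by
    rw [← mul_inv_eq_iff_eq_mul.2 htk.symm]
    exact mul_mem x.2 (inv_mem (hKH hk))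
  refine ⟨⟨t, htH⟩, ht, QuotientGroup.eq.2 ?_⟩
  rw [Subgroup.mem_subgroupOf]
  simpa [← htk] using hk

theorem exists_mul_eq_toBCF_of_isClosedMap_cosetDiagonal {H K : Subgroup G}
    (h : IsClosedMap (cosetDiagonal H K)) (f : C₀(G ⧸ H, ℂ)) (g : C₀(G ⧸ K, ℂ)) :
    ∃ k : C₀(G ⧸ (H ⊓ K), ℂ), cosetPullback (inf_le_left : H ⊓ K ≤ H) f *
      cosetPullback (inf_le_right : H ⊓ K ≤ K) g = k.toBCF := by
  have hemb : Topology.IsClosedEmbedding (cosetDiagonal H K) :=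
    .of_continuous_injective_isClosedMap (continuous_cosetDiagonal H K)
      (cosetDiagonal_injective H K) h
  refine ⟨⟨(cosetPullback (inf_le_left : H ⊓ K ≤ H) f *
      cosetPullback (inf_le_right : H ⊓ K ≤ K) g).toContinuousMap, ?_⟩, ?_⟩
  · exact ((tendsto_mul_cocompact_prod f g).comp hemb.tendsto_cocompact).congr fun _ => rfl
  · exact BoundedContinuousFunction.ext fun _ => rfl

variable [IsTopologicalGroup G]

variable [LocallyCompactSpace G]

theorem exists_isCompact_subset_image_mk (M : Subgroup G) {C : Set (G ⧸ M)} (hC : IsCompact C) :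
    ∃ T : Set G, IsCompact T ∧ C ⊆ (fun g : G => (g : G ⧸ M)) '' T := by
  refine hC.induction_on (p := fun C => ∃ T : Set G,
      IsCompact T ∧ C ⊆ (fun g : G => (g : G ⧸ M)) '' T)
    ⟨∅, isCompact_empty, Set.empty_subset _⟩ ?_ ?_ ?_
  · rintro s t hst ⟨T, hT, h⟩
    exact ⟨T, hT, hst.trans h⟩
  · rintro s t ⟨S, hS, h1⟩ ⟨T, hT, h2⟩
    refine ⟨S ∪ T, hS.union hT, ?_⟩
    rw [Set.image_union]
    exact Set.union_subset_union h1 h2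
  · intro x _
    obtain ⟨g, rfl⟩ := QuotientGroup.mk_surjective x
    obtain ⟨N, hN, hgN⟩ := exists_compact_mem_nhds g
    exact ⟨_, mem_nhdsWithin_of_mem_nhds (QuotientGroup.isOpenMap_coe.image_mem_nhds hgN),
      N, hN, le_rfl⟩

/-- Choosing `f` and `g` equal to 1 on the projections of a compact set `C` makes `k` equal to 1 on
the preimage of `C`, which is therefore contained in a compact set. -/
theorem isProperMap_cosetDiagonal_of_mul {H K : Subgroup G} [IsClosed (H : Set G)]
    [IsClosed (K : Set G)]
    (h : ∀ (f : C₀(G ⧸ H, ℂ)) (g : C₀(G ⧸ K, ℂ)), ∃ k : C₀(G ⧸ (H ⊓ K), ℂ),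
      cosetPullback (inf_le_left : H ⊓ K ≤ H) f * cosetPullback (inf_le_right : H ⊓ K ≤ K) g =
        k.toBCF) : IsProperMap (cosetDiagonal H K) := by
  rw [isProperMap_iff_isCompact_preimage]
  refine ⟨continuous_cosetDiagonal H K, fun C hC => ?_⟩
  obtain ⟨f, hf, -⟩ := exists_zeroAtInfty_eq_one (hC.image continuous_fst)
  obtain ⟨g, hg, -⟩ := exists_zeroAtInfty_eq_one (hC.image continuous_snd)
  obtain ⟨k, hk⟩ := h f g
  have h1 := k.zero_at_infty' (Metric.ball_mem_nhds 0 one_pos)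
  rw [Filter.mem_map, Filter.mem_cocompact] at h1
  obtain ⟨T, hT, hTk⟩ := h1
  refine hT.of_isClosed_subset (hC.isClosed.preimage (continuous_cosetDiagonal H K)) ?_
  intro x hx
  by_contra hxT
  have h2 := hTk hxT
  have h3 : k x = 1 := by
    have h4 : f (cosetDiagonal H K x).1 * g (cosetDiagonal H K x).2 = k x := DFunLike.congr_fun hk x
    rw [← h4, hf _ ⟨_, hx, rfl⟩, hg _ ⟨_, hx, rfl⟩, one_mul]
  have h5 : ‖k x‖ < 1 := by simpa using h2
  simp [h3] at h5

theorem tfae_closedOpenProduct (H K : Subgroup G) [hH : IsClosed (H : Set G)]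
    [hK : IsClosed (K : Set G)] :
    List.TFAE [
      ∀ (f : C₀(G ⧸ H, ℂ)) (g : C₀(G ⧸ K, ℂ)), ∃ k : C₀(G ⧸ (H ⊓ K), ℂ),
        cosetPullback (inf_le_left : H ⊓ K ≤ H) f * cosetPullback (inf_le_right : H ⊓ K ≤ K) g =
          k.toBCF,
      IsClosedMap (cosetDiagonal H K),
      ClosedOpenProduct H K,
      ClosedOpenImage H K,
      ClosedOpenImage K H] := by
  tfae_have 1 → 2 := fun h => (isProperMap_cosetDiagonal_of_mul h).isClosedMap
  tfae_have 2 → 1 := exists_mul_eq_toBCF_of_isClosedMap_cosetDiagonal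
  tfae_have 2 → 4 := closedOpenImage_of_isClosedMap_cosetDiagonal hK
  tfae_have 4 → 3 := ClosedOpenImage.closedOpenProduct
  tfae_have 3 → 2 := ClosedOpenProduct.isClosedMap_cosetDiagonal
  tfae_have 3 → 5 := fun h =>
    closedOpenImage_of_isClosedMap_cosetDiagonal hH h.symm.isClosedMap_cosetDiagonal
  tfae_have 5 → 3 := fun h => h.closedOpenProduct.symm
  tfae_finish

/-! ### Coverings by compact sets times subgroups -/

/-- The diagonal sends `K ∩ TL` into the compact product of the base point and the image of `T`;
properness bounds the preimage. -/
theorem ClosedOpenProduct.exists_isCompact_inter_subset {K L : Subgroup G}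
    [IsClosed (K : Set G)] [IsClosed (L : Set G)]
    (h : ClosedOpenProduct K L) {T : Set G} (hT : IsCompact T) :
    ∃ T' : Set G, IsCompact T' ∧
      (K : Set G) ∩ (T * (L : Set G)) ⊆ T' * ((K ⊓ L : Subgroup G) : Set G) := by
  have hemb : Topology.IsClosedEmbedding (cosetDiagonal K L) :=
    .of_continuous_injective_isClosedMap (continuous_cosetDiagonal K L)
      (cosetDiagonal_injective K L) h.isClosedMap_cosetDiagonal
  obtain ⟨T', hT', hsub⟩ := exists_isCompact_subset_image_mk _ (hemb.isCompact_preimage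
    ((isCompact_singleton (x := ((1 : G) : G ⧸ K))).prod
      (hT.image (QuotientGroup.continuous_mk (N := L)))))
  refine ⟨T', hT', ?_⟩
  rintro _ ⟨hkK, t, ht, l, hl, rfl⟩
  obtain ⟨s, hs, hst⟩ := @hsub ((t * l : G) : G ⧸ (K ⊓ L)) (by
    rw [Set.mem_preimage, cosetDiagonal_mk]
    exact ⟨(QuotientGroup.eq.2 (by simpa using hkK)).symm, t, ht,
      (QuotientGroup.mk_mul_of_mem t hl).symm⟩)
  exact ⟨s, hs, _, QuotientGroup.eq.1 hst, mul_inv_cancel_left _ _⟩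

/-- A topological version of B. H. Neumann's covering lemma. -/
theorem exists_subset_compact_mul_of_subset_iUnion {𝓢 : Set (Subgroup G)}
    (hcl : ∀ H ∈ 𝓢, IsClosed (H : Set G)) (hinf : ∀ H ∈ 𝓢, ∀ K ∈ 𝓢, H ⊓ K ∈ 𝓢)
    (hprod : ∀ H ∈ 𝓢, ∀ K ∈ 𝓢, ClosedOpenProduct H K) {ι : Type*} (F : Finset ι)
    (L : ι → Subgroup G) (hL : ∀ i ∈ F, L i ∈ 𝓢) (K : Subgroup G) (hK : K ∈ 𝓢)
    (T : ι → Set G) (hT : ∀ i ∈ F, IsCompact (T i))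
    (hcov : (K : Set G) ⊆ ⋃ i ∈ F, T i * (L i : Set G)) :
    ∃ i ∈ F, ∃ S : Set G, IsCompact S ∧ (K : Set G) ⊆ S * (L i : Set G) := by
  classical
  induction F using Finset.induction_on generalizing K T with
  | empty => simpa using hcov (one_mem K)
  | insert a s ha IH =>
    by_cases hcase : (K : Set G) ⊆ T a * (L a : Set G)
    · exact ⟨a, Finset.mem_insert_self a s, T a, hT a (Finset.mem_insert_self a s), hcase⟩
    obtain ⟨k, hk, hka⟩ := Set.not_subset.1 hcase
    have hLa := hL a (Finset.mem_insert_self a s)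
    have hLs : ∀ i ∈ s, L i ∈ 𝓢 := fun i hi => hL i (Finset.mem_insert_of_mem hi)
    have hTs : ∀ i ∈ s, IsCompact (T i) := fun i hi => hT i (Finset.mem_insert_of_mem hi)
    have hcov' : ∀ x ∈ K, x ∉ T a * (L a : Set G) → ∃ i ∈ s, x ∈ T i * (L i : Set G) := by
      intro x hx hxa
      have h1 := hcov hx
      rw [Finset.set_biUnion_insert] at h1
      obtain h1 | h1 := h1
      · exact (hxa h1).elim
      · simpa using h1
    -- The set `T a * L a` is right `L a`-invariant and misses `k`, hence misses `k(K ⊓ L a)`. The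
    -- remaining sets cover that coset; translate by `k⁻¹`.
    obtain ⟨i, hi, S, hS, hKS⟩ := IH hLs (K ⊓ L a) (hinf K hK _ hLa) (fun i => {k⁻¹} * T i)
      (fun i hi => isCompact_singleton.mul (hTs i hi)) (by
        intro x hx
        obtain ⟨j, hj, t, ht, l, hl, htl⟩ := hcov' (k * x) (mul_mem hk hx.1) (by
          rintro ⟨t, ht, l, hl, htl⟩
          refine hka ⟨t, ht, l * x⁻¹, mul_mem hl (inv_mem hx.2), ?_⟩
          simp only [] at htl ⊢
          rw [← mul_assoc, htl, mul_inv_cancel_right])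
        simp only [Set.mem_iUnion]
        refine ⟨j, hj, k⁻¹ * t, Set.mul_mem_mul rfl ht, l, hl, ?_⟩
        simp only [] at htl ⊢
        rw [mul_assoc, htl, inv_mul_cancel_left])
    have := hcl K hK
    have := hcl _ hLa
    obtain ⟨T1, hT1, hKT1⟩ :=
      (hprod K hK _ hLa).exists_isCompact_inter_subset (hT a (Finset.mem_insert_self a s))
    -- The part of `K` in `T a * L a` lies in `T1 * S * L i`, so enlarging `T i` makes the index `a`
    -- superfluous.
    obtain ⟨j, hj, S', hS', h⟩ := IH hLs K hK (fun j => T j ∪ if j = i then T1 * S else ∅)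
      (fun j hj => (hTs j hj).union (by split_ifs; exacts [hT1.mul hS, isCompact_empty])) (by
        intro x hx
        simp only [Set.mem_iUnion]
        by_cases hxa : x ∈ T a * (L a : Set G)
        · obtain ⟨t, ht, l, hl, rfl⟩ := hKT1 ⟨hx, hxa⟩
          obtain ⟨r, hr, m, hm, rfl⟩ := hKS hl
          exact ⟨i, hi, t * r, Or.inr (by rw [if_pos rfl]; exact Set.mul_mem_mul ht hr), m, hm,
            mul_assoc t r m⟩
        · obtain ⟨j, hj, hxj⟩ := hcov' x hx hxa
          exact ⟨j, hj, Set.mul_subset_mul_right Set.subset_union_left hxj⟩)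
    exact ⟨j, Finset.mem_insert_of_mem hj, S', hS', h⟩

theorem exists_subset_mul_of_compactSpace_quotient {H K : Subgroup G}
    [hc : CompactSpace (H ⧸ K.subgroupOf H)] :
    ∃ T : Set G, IsCompact T ∧ (H : Set G) ⊆ T * (K : Set G) := by
  have hcont : Continuous fun x : H => ((x : G) : G ⧸ K) :=
    QuotientGroup.continuous_mk.comp continuous_subtype_val
  have h2 : IsCompact ((fun g : G => (g : G ⧸ K)) '' (H : Set G)) := by
    have hlift : Continuous (Quotient.lift (s := QuotientGroup.leftRel (K.subgroupOf H))
        (fun x : H => ((x : G) : G ⧸ K)) (by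
        intro a b hab
        rw [← Quotient.eq_iff_equiv] at hab
        exact QuotientGroup.eq.2 (Subgroup.mem_subgroupOf.1 (QuotientGroup.eq.1 hab)))) :=
      hcont.quotient_lift _
    convert! isCompact_range hlift
    ext y
    constructor
    · rintro ⟨x, hx, rfl⟩
      exact ⟨Quotient.mk _ ⟨x, hx⟩, rfl⟩
    · rintro ⟨x, rfl⟩
      induction x using Quotient.inductionOn with | h x => exact ⟨x, x.2, rfl⟩
  obtain ⟨T, hT, hsub⟩ := exists_isCompact_subset_image_mk K h2
  refine ⟨T, hT, fun x hx => ?_⟩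
  obtain ⟨t, ht, htx⟩ := hsub ⟨x, hx, rfl⟩
  exact ⟨t, ht, _, QuotientGroup.eq.1 htx, mul_inv_cancel_left _ _⟩

/-- Compactness of `H ⧸ K` makes `G ⧸ K → G ⧸ H` proper: with `H ⊆ TK`, the preimage of the image of
`S` lies in the image of `ST`. -/
theorem exists_cosetPullback_eq_toBCF {H K : Subgroup G} [IsClosed (H : Set G)] (hKH : K ≤ H)
    (hc : CompactSpace (H ⧸ K.subgroupOf H)) (f : C₀(G ⧸ H, ℂ)) :
    ∃ k : C₀(G ⧸ K, ℂ), cosetPullback hKH f = k.toBCF := by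
  obtain ⟨T, hT, hHT⟩ := exists_subset_mul_of_compactSpace_quotient (H := H) (K := K)
  refine ⟨⟨(cosetPullback hKH f).toContinuousMap, ?_⟩, rfl⟩
  have : Filter.Tendsto (cosetProjection hKH) (Filter.cocompact _) (Filter.cocompact _) := by
    have hp : IsProperMap (cosetProjection hKH) := by
      rw [isProperMap_iff_isCompact_preimage]
      refine ⟨(cosetProjection hKH).continuous, fun C hC => ?_⟩
      obtain ⟨S, hS, hCS⟩ := exists_isCompact_subset_image_mk H hC
      refine ((hS.mul hT).image (QuotientGroup.continuous_mk (N := K))).of_isClosed_subset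
        (hC.isClosed.preimage (cosetProjection hKH).continuous) fun x hx => ?_
      induction x using QuotientGroup.induction_on with | H x => ?_
      obtain ⟨s, hs, hsx⟩ := hCS hx
      obtain ⟨t, ht, k, hk, htk⟩ := hHT (QuotientGroup.eq.1
        (show (s : G ⧸ H) = (x : G ⧸ H) from hsx))
      refine ⟨s * t, Set.mul_mem_mul hs ht, QuotientGroup.eq.2 ?_⟩
      simp only [] at htk
      rwa [mul_inv_rev, mul_assoc, ← htk, inv_mul_cancel_left]
    exact (isProperMap_iff_tendsto_cocompact.1 hp).2
  exact f.zero_at_infty'.comp this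

end Cosets

theorem iSupIndep_of_finset_sum_eq_zero {ι R N : Type*} [Ring R] [AddCommGroup N] [Module R N]
    (p : ι → Submodule R N)
    (h : ∀ (F : Finset ι) (v : ι → N), (∀ i, v i ∈ p i) → ∑ i ∈ F, v i = 0 → ∀ i ∈ F, v i = 0) :
    iSupIndep p := by
  classical
  refine iSupIndep_of_dfinsupp_lsum_injective p ((injective_iff_map_eq_zero _).2 fun m hm => ?_)
  rw [DFinsupp.lsum_apply_apply, DFinsupp.sumAddHom_apply, DFinsupp.sum] at hm
  ext i
  by_cases hi : i ∈ m.support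
  · exact h m.support (fun i => m i) (fun i => (m i).2) hm i hi
  · simpa using hi

/-! ### Construction of the graded algebra -/

section Construction

variable {G : Type u} [Group G] [TopologicalSpace G]

/-- A family of compatible embeddings of the algebras `C₀(G ⧸ H)`, independent and with total
range, gives a coset grading. -/
noncomputable def CosetGrading.ofEmbeddings (ℒ : SubSemilattice (ClosedSubgroup G)) {𝔄 : Type v}
    [NonUnitalCStarAlgebra 𝔄] (j : ∀ H : ℒ, C₀(G ⧸ H.1.toSubgroup, ℂ) →⋆ₙₐ[ℂ] 𝔄)
    (hinj : ∀ H, Function.Injective (j H))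
    (hind : iSupIndep fun H => (NonUnitalStarAlgHom.range (j H)).toSubmodule)
    (htot : Dense ((Submodule.span ℂ (⋃ H, (NonUnitalStarAlgHom.range (j H) : Set 𝔄)) :
      Submodule ℂ 𝔄) : Set 𝔄))
    (hmul : ∀ H K f g, j H f * j K g ∈ NonUnitalStarAlgHom.range (j (H ⊓ K)))
    (hfst : ∀ (K H : ℒ) (h : K ≤ H) f g, j H f * j K g = j K (boundedMulZeroAtInfty
      (cosetPullback (K := K.1.toSubgroup) (H := H.1.toSubgroup) h f) g))
    (hsnd : ∀ (K H : ℒ) (h : K ≤ H) f g, j K g * j H f = j K (boundedMulZeroAtInfty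
      (cosetPullback (K := K.1.toSubgroup) (H := H.1.toSubgroup) h f) g)) :
    CosetGrading ℒ 𝔄 where
  component H := NonUnitalStarAlgHom.range (j H)
  isGraded :=
    { isClosed := fun H => by
        rw [NonUnitalStarAlgHom.coe_range]
        exact (NonUnitalStarAlgHom.isometry (j H) (hinj H)).isClosedEmbedding.isClosed_range
      independent := hind
      total := htot
      mul_mem := by
        rintro H K _ ⟨f, rfl⟩ _ ⟨g, rfl⟩
        exact hmul H K f g }
  iso H := StarAlgEquiv.ofInjective' (j H) (hinj H)
  structureMorphism_fst K H h f g := Subtype.ext (hfst K H h f g)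
  structureMorphism_snd K H h f g := Subtype.ext (hsnd K H h f g)

open Classical in
/-- The function `(K, g) ↦ f (g H)` for `K ≤ H`, extended by zero to the other `K`. -/
noncomputable def gradedPullback (ℒ : SubSemilattice (ClosedSubgroup G)) (H : ℒ) :
    C₀(G ⧸ H.1.toSubgroup, ℂ) →⋆ₙₐ[ℂ] ((Σ _ : ℒ, G) →ᵇ ℂ) where
  toFun f := BoundedContinuousFunction.ofNormedAddCommGroup
    (fun x => if x.1 ≤ H then f (x.2 : G ⧸ H.1.toSubgroup) else 0)
    (continuous_sigma fun K => by
      by_cases h : K ≤ H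
      · simp only [h, if_true]
        exact f.continuous.comp QuotientGroup.continuous_mk
      · simpa only [h, if_false] using continuous_const)
    ‖f.toBCF‖ (fun x => by
      split_ifs
      · exact f.toBCF.norm_coe_le_norm _
      · simp)
  map_smul' c f := by ext x; simp
  map_zero' := by ext x; simp
  map_add' f g := by
    ext x
    by_cases h : x.1 ≤ H <;> simp [h]
  map_mul' f g := by
    ext x
    by_cases h : x.1 ≤ H <;> simp [h]
  map_star' f := by
    ext x
    by_cases h : x.1 ≤ H <;> simp [h]

theorem gradedPullback_of_le {ℒ : SubSemilattice (ClosedSubgroup G)} {H K : ℒ} (h : K ≤ H)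
    (f : C₀(G ⧸ H.1.toSubgroup, ℂ)) (g : G) :
    gradedPullback ℒ H f ⟨K, g⟩ = f (g : G ⧸ H.1.toSubgroup) := if_pos h

theorem gradedPullback_of_not_le {ℒ : SubSemilattice (ClosedSubgroup G)} {H K : ℒ} (h : ¬ K ≤ H)
    (f : C₀(G ⧸ H.1.toSubgroup, ℂ)) (g : G) : gradedPullback ℒ H f ⟨K, g⟩ = 0 := if_neg h

theorem gradedPullback_injective {ℒ : SubSemilattice (ClosedSubgroup G)} (H : ℒ) :
    Function.Injective (gradedPullback ℒ H) := by
  intro f g hfg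
  ext x
  obtain ⟨x, rfl⟩ := QuotientGroup.mk_surjective x
  rw [← gradedPullback_of_le le_rfl, hfg, gradedPullback_of_le le_rfl]

/-- If `H` is maximal among the indices with nonzero term, only its term survives on the sheet `H`.
-/
theorem gradedPullback_sum_eq_zero {ℒ : SubSemilattice (ClosedSubgroup G)} (F : Finset ℒ)
    (f : ∀ H : ℒ, C₀(G ⧸ H.1.toSubgroup, ℂ)) (h : ∑ H ∈ F, gradedPullback ℒ H (f H) = 0) :
    ∀ H ∈ F, f H = 0 := by
  classical
  by_contra! hne
  obtain ⟨H, hH⟩ := (F.filter fun H => f H ≠ 0).exists_maximal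
    (by obtain ⟨H, hH, hf⟩ := hne; exact ⟨H, by simp [hH, hf]⟩)
  have hHF := Finset.mem_filter.1 hH.prop
  refine hHF.2 (ZeroAtInftyContinuousMap.ext fun x => ?_)
  obtain ⟨x, rfl⟩ := QuotientGroup.mk_surjective x
  have h1 := DFunLike.congr_fun h ⟨H, x⟩
  rw [BoundedContinuousFunction.sum_apply, Finset.sum_eq_single_of_mem H hHF.1,
    gradedPullback_of_le le_rfl] at h1
  · exact h1
  · intro K hK hKH
    by_cases hle : H ≤ K
    · by_cases hfK : f K = 0
      · rw [hfK, map_zero]; rfl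
      · exact (hKH (le_antisymm (hH.le_of_ge (Finset.mem_filter.2 ⟨hK, hfK⟩) hle) hle)).elim
    · exact gradedPullback_of_not_le hle _ _

theorem gradedPullback_mul_of_le {ℒ : SubSemilattice (ClosedSubgroup G)} {K H : ℒ} (h : K ≤ H)
    (f : C₀(G ⧸ H.1.toSubgroup, ℂ)) (g : C₀(G ⧸ K.1.toSubgroup, ℂ)) :
    gradedPullback ℒ H f * gradedPullback ℒ K g = gradedPullback ℒ K (boundedMulZeroAtInfty
      (cosetPullback (K := K.1.toSubgroup) (H := H.1.toSubgroup) h f) g) := by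
  ext ⟨M, x⟩
  rw [BoundedContinuousFunction.mul_apply]
  by_cases hM : M ≤ K
  · rw [gradedPullback_of_le hM, gradedPullback_of_le hM, gradedPullback_of_le (hM.trans h)]
    rfl
  · rw [gradedPullback_of_not_le hM, gradedPullback_of_not_le hM, mul_zero]

variable [IsTopologicalGroup G] {ℒ : SubSemilattice (ClosedSubgroup G)}

theorem gradedPullback_mul_mem
    (hℒ : ∀ H ∈ ℒ.carrier, ∀ K ∈ ℒ.carrier, ClosedOpenProduct H.toSubgroup K.toSubgroup)
    (H K : ℒ) (f : C₀(G ⧸ H.1.toSubgroup, ℂ)) (g : C₀(G ⧸ K.1.toSubgroup, ℂ)) :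
    gradedPullback ℒ H f * gradedPullback ℒ K g ∈
      NonUnitalStarAlgHom.range (gradedPullback ℒ (H ⊓ K)) := by
  obtain ⟨k, hk⟩ := exists_mul_eq_toBCF_of_isClosedMap_cosetDiagonal
    (hℒ H.1 H.2 K.1 K.2).isClosedMap_cosetDiagonal f g
  refine ⟨k, BoundedContinuousFunction.ext ?_⟩
  rintro ⟨M, x⟩
  change gradedPullback ℒ (H ⊓ K) k ⟨M, x⟩ = _
  rw [BoundedContinuousFunction.mul_apply]
  by_cases hM : M ≤ H ⊓ K
  · rw [gradedPullback_of_le hM, gradedPullback_of_le (le_inf_iff.1 hM).1,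
      gradedPullback_of_le (le_inf_iff.1 hM).2]
    exact (DFunLike.congr_fun hk (x : G ⧸ (H.1.toSubgroup ⊓ K.1.toSubgroup))).symm
  · rw [gradedPullback_of_not_le hM]
    rw [le_inf_iff, not_and_or] at hM
    obtain hM | hM := hM
    · rw [gradedPullback_of_not_le hM, zero_mul]
    · rw [gradedPullback_of_not_le hM (H := K), mul_zero]

/-- The union of the embedded components is stable under products and star, so the star algebra it
generates is just its linear span; the closure of this is the graded algebra. -/
theorem exists_cosetGrading
    (hℒ : ∀ H ∈ ℒ.carrier, ∀ K ∈ ℒ.carrier, ClosedOpenProduct H.toSubgroup K.toSubgroup) :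
    ∃ (𝔄 : Type u) (_ : NonUnitalCStarAlgebra 𝔄), Nonempty (CosetGrading ℒ 𝔄) := by
  set S : Set ((Σ _ : ℒ, G) →ᵇ ℂ) :=
    ⋃ H : ℒ, (NonUnitalStarAlgHom.range (gradedPullback ℒ H) : Set _) with hS
  have hSmul : ∀ x ∈ S, ∀ y ∈ S, x * y ∈ S := by
    intro x hx y hy
    obtain ⟨H, f, rfl⟩ := Set.mem_iUnion.1 hx
    obtain ⟨K, g, rfl⟩ := Set.mem_iUnion.1 hy
    exact Set.mem_iUnion.2 ⟨H ⊓ K, gradedPullback_mul_mem hℒ H K f g⟩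
  have hSstar : S ∪ star S = S := by
    refine Set.union_eq_self_of_subset_right fun x hx => ?_
    obtain ⟨H, hH⟩ := Set.mem_iUnion.1 (Set.mem_star.1 hx)
    exact Set.mem_iUnion.2 ⟨H, by simpa using star_mem hH⟩
  have hspan : ((NonUnitalStarAlgebra.adjoin ℂ S : NonUnitalStarSubalgebra ℂ _) :
      Set ((Σ _ : ℒ, G) →ᵇ ℂ)) = Submodule.span ℂ S := by
    have h1 := NonUnitalStarAlgebra.adjoin_eq_span (R := ℂ) S
    have h2 : ((Subsemigroup.closure S : Subsemigroup _) : Set _) = S :=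
      congrArg _ (Subsemigroup.closure_eq
        (⟨S, fun {a b} ha hb => hSmul a ha b hb⟩ : Subsemigroup _))
    rw [hSstar, h2] at h1
    exact congrArg (SetLike.coe (B := (Σ _ : ℒ, G) →ᵇ ℂ)) h1
  set 𝔅 := (NonUnitalStarAlgebra.adjoin ℂ S).topologicalClosure with h𝔅
  have : IsClosed (𝔅 : Set ((Σ _ : ℒ, G) →ᵇ ℂ)) :=
    NonUnitalStarSubalgebra.isClosed_topologicalClosure _
  have hmem : ∀ (H : ℒ) f, gradedPullback ℒ H f ∈ 𝔅 := fun H f =>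
    NonUnitalStarSubalgebra.le_topologicalClosure _ (NonUnitalStarAlgebra.subset_adjoin ℂ S
      (Set.mem_iUnion.2 ⟨H, f, rfl⟩))
  let j : ∀ H : ℒ, C₀(G ⧸ H.1.toSubgroup, ℂ) →⋆ₙₐ[ℂ] 𝔅 := fun H =>
    NonUnitalStarAlgHom.codRestrict (gradedPullback ℒ H) 𝔅 (hmem H)
  have hj : ∀ H f, (j H f : (Σ _ : ℒ, G) →ᵇ ℂ) = gradedPullback ℒ H f := fun H f => rfl
  refine ⟨𝔅, inferInstance, ⟨CosetGrading.ofEmbeddings ℒ j ?_ ?_ ?_ ?_ ?_ ?_⟩⟩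
  · intro H f g hfg
    exact gradedPullback_injective H (congrArg Subtype.val hfg)
  · refine iSupIndep_of_finset_sum_eq_zero _ fun F v hv hsum => ?_
    choose f hf using hv
    have hf' : ∀ H, j H (f H) = v H := hf
    have h0 : ∑ H ∈ F, gradedPullback ℒ H (f H) = 0 := by
      have h1 := congrArg (Subtype.val : 𝔅 → _) hsum
      simp_rw [← hf'] at h1
      simpa [hj] using h1
    intro H hH
    rw [← hf', gradedPullback_sum_eq_zero F f h0 H hH, map_zero]
  · rw [Subtype.dense_iff]
    intro x hx
    have h1 : x ∈ closure (Submodule.span ℂ S : Set ((Σ _ : ℒ, G) →ᵇ ℂ)) := by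
      rw [← hspan]; exact hx
    refine closure_mono ?_ h1
    have h2 : Submodule.span ℂ S ≤ (Submodule.span ℂ (⋃ H, (NonUnitalStarAlgHom.range (j H) :
        Set 𝔅))).map (NonUnitalStarSubalgebraClass.subtype 𝔅 : 𝔅 →ₗ[ℂ] _) := by
      rw [Submodule.map_span, Submodule.span_le]
      intro y hy
      obtain ⟨H, f, rfl⟩ := Set.mem_iUnion.1 hy
      exact Submodule.subset_span ⟨j H f, Set.mem_iUnion.2 ⟨H, f, rfl⟩, rfl⟩
    exact h2
  · intro H K f g
    obtain ⟨k, hk⟩ := gradedPullback_mul_mem hℒ H K f g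
    exact ⟨k, Subtype.ext hk⟩
  · intro K H h f g
    exact Subtype.ext (gradedPullback_mul_of_le h f g)
  · intro K H h f g
    refine Subtype.ext ?_
    rw [← show _ = (j K (boundedMulZeroAtInfty _ g) : (Σ _ : ℒ, G) →ᵇ ℂ) from
      gradedPullback_mul_of_le h f g]
    exact mul_comm (gradedPullback ℒ K g) (gradedPullback ℒ H f)

end Construction

/-! ### Extending contractions from finite sums -/

section FamilySums

variable {ι : Type*} {M : ι → Type*} [∀ i, AddCommGroup (M i)] [∀ i, Module ℂ (M i)]
  {A B : Type*} [NormedAddCommGroup A] [NormedSpace ℂ A] [NormedAddCommGroup B] [NormedSpace ℂ B]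

open Classical in
theorem DFinsupp.lsum_eq_sum_support (e : ∀ i, M i →ₗ[ℂ] A) (m : Π₀ i, M i) :
    DFinsupp.lsum ℂ e m = ∑ i ∈ m.support, e i (m i) := by
  rw [DFinsupp.lsum_apply_apply, DFinsupp.sumAddHom_apply, DFinsupp.sum]
  rfl

theorem denseRange_lsum_of_dense_span [DecidableEq ι] (e : ∀ i, M i →ₗ[ℂ] A)
    (he : Dense ((Submodule.span ℂ (⋃ i, Set.range (e i)) : Submodule ℂ A) : Set A)) :
    DenseRange (DFinsupp.lsum ℂ e) := by
  refine he.mono ?_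
  rw [← LinearMap.coe_range, SetLike.coe_subset_coe, Submodule.span_le]
  intro x hx
  obtain ⟨i, m, rfl⟩ := Set.mem_iUnion.1 hx
  exact ⟨_, DFinsupp.lsum_single _ _ _ _⟩

theorem dense_finset_sums (e : ∀ i, M i →ₗ[ℂ] A)
    (he : Dense ((Submodule.span ℂ (⋃ i, Set.range (e i)) : Submodule ℂ A) : Set A)) :
    Dense {x : A | ∃ (F : Finset ι) (m : ∀ i, M i), x = ∑ i ∈ F, e i (m i)} := by
  classical
  refine (denseRange_lsum_of_dense_span e he).mono ?_
  rintro _ ⟨m, rfl⟩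
  exact ⟨m.support, fun i => m i, DFinsupp.lsum_eq_sum_support e m⟩

/-- A contractive map defined on the sum of a total family of subspaces extends to the whole
space. -/
theorem exists_continuousLinearMap_extending [CompleteSpace B] (e : ∀ i, M i →ₗ[ℂ] A)
    (f : ∀ i, M i →ₗ[ℂ] B)
    (he : Dense ((Submodule.span ℂ (⋃ i, Set.range (e i)) : Submodule ℂ A) : Set A))
    (h : ∀ (F : Finset ι) (m : ∀ i, M i), ‖∑ i ∈ F, f i (m i)‖ ≤ ‖∑ i ∈ F, e i (m i)‖) :
    ∃ φ : A →L[ℂ] B, ∀ i m, φ (e i m) = f i m := by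
  classical
  have h' : ∀ m, ‖DFinsupp.lsum ℂ f m‖ ≤ 1 * ‖DFinsupp.lsum ℂ e m‖ := fun m => by
    rw [one_mul, DFinsupp.lsum_eq_sum_support, DFinsupp.lsum_eq_sum_support]
    exact h _ _
  refine ⟨(DFinsupp.lsum ℂ f).extendOfNorm (DFinsupp.lsum ℂ e), fun i m => ?_⟩
  rw [← DFinsupp.lsum_single ℂ e i m, LinearMap.extendOfNorm_eq
    (denseRange_lsum_of_dense_span e he) ⟨1, h'⟩, DFinsupp.lsum_single]

end FamilySums

/-! ### The natural homomorphism -/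

namespace CosetGrading

section Basic

variable {G : Type u} [Group G] [TopologicalSpace G] {ℒ : SubSemilattice (ClosedSubgroup G)}
  {𝔄 : Type v} [NonUnitalCStarAlgebra 𝔄] (S : CosetGrading ℒ 𝔄)

/-- The embedding of the component `C₀(G ⧸ H)` in the graded algebra. -/
noncomputable def incl (H : ℒ) : C₀(G ⧸ H.1.toSubgroup, ℂ) →⋆ₙₐ[ℂ] 𝔄 :=
  (NonUnitalStarSubalgebraClass.subtype (S.component H)).comp
    (S.iso H : C₀(G ⧸ H.1.toSubgroup, ℂ) →⋆ₙₐ[ℂ] S.component H)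

theorem incl_mem (H : ℒ) (f : C₀(G ⧸ H.1.toSubgroup, ℂ)) : S.incl H f ∈ S.component H :=
  (S.iso H f).2

theorem exists_incl_eq {H : ℒ} {x : 𝔄} (hx : x ∈ S.component H) : ∃ f, S.incl H f = x := by
  obtain ⟨f, hf⟩ := (S.iso H).surjective ⟨x, hx⟩
  exact ⟨f, congrArg Subtype.val hf⟩

theorem incl_injective (H : ℒ) : Function.Injective (S.incl H) := fun _ _ h =>
  (S.iso H).injective (Subtype.ext h)

theorem norm_incl (H : ℒ) (f : C₀(G ⧸ H.1.toSubgroup, ℂ)) : ‖S.incl H f‖ = ‖f‖ :=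
  NonUnitalStarAlgHom.norm_map (S.incl H) (S.incl_injective H) f

theorem incl_mul_incl_of_le {K H : ℒ} (h : K ≤ H) (f : C₀(G ⧸ H.1.toSubgroup, ℂ))
    (g : C₀(G ⧸ K.1.toSubgroup, ℂ)) :
    S.incl H f * S.incl K g = S.incl K (boundedMulZeroAtInfty
      (cosetPullback (K := K.1.toSubgroup) (H := H.1.toSubgroup) h f) g) :=
  congrArg Subtype.val (S.structureMorphism_fst K H h f g)

theorem exists_sum_incl_mul (K : ℒ) (F : Finset ℒ) (hF : ∀ H ∈ F, K ≤ H)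
    (f : ∀ H : ℒ, C₀(G ⧸ H.1.toSubgroup, ℂ)) :
    ∃ y : (G ⧸ K.1.toSubgroup) →ᵇ ℂ,
      (∀ g : G, y g = ∑ H ∈ F, f H (g : G ⧸ H.1.toSubgroup)) ∧
      ∀ u, (∑ H ∈ F, S.incl H (f H)) * S.incl K u = S.incl K (boundedMulZeroAtInfty y u) := by
  classical
  induction F using Finset.induction_on with
  | empty =>
    refine ⟨0, fun g => by simp, fun u => ?_⟩
    rw [Finset.sum_empty, zero_mul, show boundedMulZeroAtInfty 0 u = 0 from
      ZeroAtInftyContinuousMap.ext fun x => zero_mul (u x), map_zero]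
  | insert a s ha IH =>
    obtain ⟨y, hy, hyu⟩ := IH fun H hH => hF H (Finset.mem_insert_of_mem hH)
    have hKa := hF a (Finset.mem_insert_self a s)
    refine ⟨cosetPullback (K := K.1.toSubgroup) (H := a.1.toSubgroup) hKa (f a) + y,
      fun g => ?_, fun u => ?_⟩
    · rw [Finset.sum_insert ha, ← hy]
      rfl
    · rw [Finset.sum_insert ha, add_mul, hyu, S.incl_mul_incl_of_le hKa, ← map_add]
      exact congrArg _ (ZeroAtInftyContinuousMap.ext fun x => (add_mul _ _ (u x)).symm)

/-- The embedding of the component `C₀(G ⧸ H)` as a linear map. -/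
noncomputable def inclLinear (H : ℒ) : C₀(G ⧸ H.1.toSubgroup, ℂ) →ₗ[ℂ] 𝔄 where
  toFun := S.incl H
  map_add' := map_add _
  map_smul' := map_smul _

theorem dense_span_range_incl : Dense ((Submodule.span ℂ
    (⋃ H, Set.range (S.inclLinear H)) : Submodule ℂ 𝔄) : Set 𝔄) := by
  refine S.isGraded.total.mono (Submodule.span_mono (Set.iUnion_mono fun H x hx => ?_))
  obtain ⟨f, rfl⟩ := S.exists_incl_eq hx
  exact ⟨f, rfl⟩

theorem dense_sum_incl : Dense {x : 𝔄 | ∃ (F : Finset ℒ) (f : ∀ H : ℒ, C₀(G ⧸ H.1.toSubgroup, ℂ)),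
    x = ∑ H ∈ F, S.incl H (f H)} :=
  dense_finset_sums (M := fun H : ℒ => C₀(G ⧸ H.1.toSubgroup, ℂ)) S.inclLinear
    S.dense_span_range_incl

theorem induction {P : 𝔄 → Prop} (hclosed : IsClosed {x | P x}) (zero : P 0)
    (add : ∀ x y, P x → P y → P (x + y)) (incl : ∀ H f, P (S.incl H f)) (x : 𝔄) : P x := by
  refine S.dense_sum_incl.induction ?_ hclosed x
  rintro _ ⟨F, f, rfl⟩
  exact Finset.sum_induction _ P add zero fun H _ => incl H _

/-- The pullback `f ↦ f ∘ p_H` as a linear map. -/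
noncomputable def _root_.groupPullbackLinear (H : Subgroup G) :
    C₀(G ⧸ H, ℂ) →ₗ[ℂ] (G →ᵇ ℂ) where
  toFun := groupPullback H
  map_add' _ _ := rfl
  map_smul' _ _ := rfl

theorem _root_.groupPullback_apply (H : Subgroup G) (f : C₀(G ⧸ H, ℂ)) (g : G) :
    groupPullback H f g = f (g : G ⧸ H) := rfl

theorem IsNatural.apply_incl {φ : 𝔄 →⋆ₙₐ[ℂ] (G →ᵇ ℂ)} {S : CosetGrading ℒ 𝔄} (hφ : S.IsNatural φ)
    (H : ℒ) (f : C₀(G ⧸ H.1.toSubgroup, ℂ)) :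
    φ (S.incl H f) = groupPullback H.1.toSubgroup f := hφ H f

open scoped CStarAlgebra in
theorem IsNatural.unique {φ φ' : 𝔄 →⋆ₙₐ[ℂ] (G →ᵇ ℂ)} {S : CosetGrading ℒ 𝔄} (hφ : S.IsNatural φ)
    (hφ' : S.IsNatural φ') : φ = φ' := by
  ext1 x
  refine S.induction (isClosed_eq (map_continuous φ) (map_continuous φ')) (by simp)
    (fun a b ha hb => by rw [map_add, map_add, ha, hb]) (fun H f => ?_) x
  rw [hφ.apply_incl, hφ'.apply_incl]

variable [IsTopologicalGroup G] [LocallyCompactSpace G]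

/-- Structure morphisms only describe products of comparable components. Multiplying by `u ∈ A_{H ⊓
K}` with value 1 at the given point reduces the general product to that case. -/
theorem incl_mul_incl {H K : ℒ} (f : C₀(G ⧸ H.1.toSubgroup, ℂ)) (g : C₀(G ⧸ K.1.toSubgroup, ℂ)) :
    ∃ k : C₀(G ⧸ (H ⊓ K).1.toSubgroup, ℂ), S.incl H f * S.incl K g = S.incl (H ⊓ K) k ∧
      ∀ x : G, k x = f x * g x := by
  obtain ⟨k, hk⟩ := S.exists_incl_eq (S.isGraded.mul_mem H K _ (S.incl_mem H f) _ (S.incl_mem K g))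
  refine ⟨k, hk.symm, fun x => ?_⟩
  obtain ⟨u, hu, -⟩ := exists_zeroAtInfty_eq_one
    (isCompact_singleton (x := (x : G ⧸ (H ⊓ K).1.toSubgroup)))
  have h1 : S.incl (H ⊓ K) (k * u) = S.incl H f * (S.incl K g * S.incl (H ⊓ K) u) := by
    rw [map_mul, hk, mul_assoc]
  rw [S.incl_mul_incl_of_le inf_le_right, S.incl_mul_incl_of_le inf_le_left] at h1
  have h2 : k x * u x = f x * (g x * u x) := DFunLike.congr_fun (S.incl_injective _ h1) _
  simpa [hu _ rfl] using h2

theorem mul_comm (S : CosetGrading ℒ 𝔄) (x y : 𝔄) : x * y = y * x := by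
  refine S.induction (P := fun x => x * y = y * x)
      (isClosed_eq (by fun_prop) (by fun_prop)) (by simp)
    (fun a b ha hb => by rw [add_mul, mul_add, ha, hb]) (fun H f => ?_) x
  refine S.induction (P := fun y => S.incl H f * y = y * S.incl H f)
      (isClosed_eq (by fun_prop) (by fun_prop)) (by simp)
    (fun a b ha hb => by rw [add_mul, mul_add, ha, hb]) (fun K g => ?_) y
  obtain ⟨k, hk, hk'⟩ := S.incl_mul_incl f g
  obtain ⟨l, hl, hl'⟩ := S.incl_mul_incl g f
  rw [hk, hl]
  -- The two products are functions on the quotients by `H ⊓ K` and `K ⊓ H`, which are different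
  -- types; their values are compared on `G`.
  have key : ∀ M N : ℒ, M = N → ∀ (a : C₀(G ⧸ M.1.toSubgroup, ℂ)) (b : C₀(G ⧸ N.1.toSubgroup, ℂ)),
      (∀ x : G, a x = b x) → S.incl M a = S.incl N b := by
    rintro M _ rfl a b hab
    congr 1
    ext x
    obtain ⟨x, rfl⟩ := QuotientGroup.mk_surjective x
    exact hab x
  exact key _ _ (inf_comm H K) k l fun x => by rw [hk', hl', _root_.mul_comm]

/-- Let `K` be the meet of `F` and `u ∈ A_K` of norm at most 1 with value 1 at `gK`. The value at
`g` is that of the sum multiplied by `u`, a product in `A_K`. -/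
theorem norm_sum_groupPullback_le (F : Finset ℒ) (f : ∀ H : ℒ, C₀(G ⧸ H.1.toSubgroup, ℂ)) :
    ‖∑ H ∈ F, groupPullback H.1.toSubgroup (f H)‖ ≤ ‖∑ H ∈ F, S.incl H (f H)‖ := by
  obtain rfl | hF := F.eq_empty_or_nonempty
  · simp
  rw [BoundedContinuousFunction.norm_le (norm_nonneg _)]
  intro g
  set K := F.inf' hF id with hK
  obtain ⟨y, hy, hyu⟩ := S.exists_sum_incl_mul K F (fun H hH => Finset.inf'_le id hH) f
  obtain ⟨u, hu, hu1, -⟩ := exists_zeroAtInfty_eq_one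
    (isCompact_singleton (x := (g : G ⧸ K.1.toSubgroup)))
  have hun : ‖u‖ ≤ 1 := by
    rw [← ZeroAtInftyContinuousMap.norm_toBCF_eq_norm]
    exact (BoundedContinuousFunction.norm_le zero_le_one).2 hu1
  calc ‖(∑ H ∈ F, groupPullback H.1.toSubgroup (f H)) g‖
      = ‖boundedMulZeroAtInfty y u (g : G ⧸ K.1.toSubgroup)‖ := by
        change _ = ‖y g * u g‖
        rw [hu _ rfl, mul_one, hy, BoundedContinuousFunction.sum_apply]
        rfl
    _ ≤ ‖boundedMulZeroAtInfty y u‖ := by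
        rw [← ZeroAtInftyContinuousMap.norm_toBCF_eq_norm]
        exact (boundedMulZeroAtInfty y u).toBCF.norm_coe_le_norm _
    _ = ‖(∑ H ∈ F, S.incl H (f H)) * S.incl K u‖ := by rw [hyu, norm_incl]
    _ ≤ ‖∑ H ∈ F, S.incl H (f H)‖ * ‖S.incl K u‖ := norm_mul_le _ _
    _ ≤ ‖∑ H ∈ F, S.incl H (f H)‖ := by
        rw [norm_incl]
        exact mul_le_of_le_one_right (norm_nonneg _) hun

theorem exists_continuousLinearMap : ∃ φ : 𝔄 →L[ℂ] (G →ᵇ ℂ),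
    ∀ H f, φ (S.incl H f) = groupPullback H.1.toSubgroup f :=
  exists_continuousLinearMap_extending (M := fun H : ℒ => C₀(G ⧸ H.1.toSubgroup, ℂ)) S.inclLinear
    (fun H => groupPullbackLinear H.1.toSubgroup) S.dense_span_range_incl
    S.norm_sum_groupPullback_le

theorem exists_isNatural : ∃ φ : 𝔄 →⋆ₙₐ[ℂ] (G →ᵇ ℂ), S.IsNatural φ := by
  obtain ⟨φ, hincl⟩ := S.exists_continuousLinearMap
  refine ⟨{
    toFun := φ
    map_smul' := map_smul φ
    map_add' := map_add φ
    map_zero' := map_zero φ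
    map_mul' := fun x y => ?_
    map_star' := fun x => ?_ }, hincl⟩
  · change φ (x * y) = φ x * φ y
    refine S.induction (P := fun x => φ (x * y) = φ x * φ y)
      (isClosed_eq (by fun_prop) (by fun_prop)) (by simp)
      (fun a b ha hb => by rw [add_mul, map_add, map_add, add_mul, ha, hb]) (fun H f => ?_) x
    refine S.induction (P := fun y => φ (S.incl H f * y) = φ (S.incl H f) * φ y)
      (isClosed_eq (by fun_prop) (by fun_prop)) (by simp)
      (fun a b ha hb => by rw [mul_add, map_add, map_add, mul_add, ha, hb]) (fun K g => ?_) y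
    obtain ⟨k, hk, hk'⟩ := S.incl_mul_incl f g
    rw [hk, hincl, hincl, hincl]
    ext x
    exact hk' x
  · refine S.induction (P := fun x => φ (star x) = star (φ x))
      (isClosed_eq (by fun_prop) (by fun_prop)) (by simp)
      (fun a b ha hb => by rw [star_add, map_add, map_add, star_add, ha, hb]) (fun H f => ?_) x
    rw [← map_star, hincl, hincl]
    rfl

end Basic

end CosetGrading

/-! ### Characters and the injectivity criterion -/

theorem norm_le_of_forall_character {A : Type*} [NonUnitalCStarAlgebra A]
    (hcomm : ∀ x y : A, x * y = y * x) {x : A} {c : ℝ} (hc : 0 ≤ c)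
    (h : ∀ χ : A →ₙₐ[ℂ] ℂ, (∀ a, ‖χ a‖ ≤ ‖a‖) → ‖χ x‖ ≤ c) : ‖x‖ ≤ c := by
  let : NonUnitalCommCStarAlgebra A := { ‹NonUnitalCStarAlgebra A› with mul_comm := hcomm }
  have h1 := (gelfandTransform_isometry (Unitization ℂ A)).norm_map_of_map_zero (map_zero _)
    (x : Unitization ℂ A)
  rw [Unitization.norm_inr] at h1
  rw [← h1, ContinuousMap.norm_le _ hc]
  intro χ
  refine h ((WeakDual.CharacterSpace.toNonUnitalAlgHom χ).comp
    (Unitization.inrNonUnitalAlgHom ℂ A)) fun a => ?_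
  refine (?_ : _ ≤ ‖(a : Unitization ℂ A)‖).trans_eq (Unitization.norm_inr a)
  exact AlgHom.norm_apply_le_self (WeakDual.CharacterSpace.toAlgHom χ) (a : Unitization ℂ A)

theorem ZeroAtInftyContinuousMap.exists_isCompact_norm_lt {X : Type*} [TopologicalSpace X]
    (f : C₀(X, ℂ)) {ε : ℝ} (hε : 0 < ε) : ∃ C : Set X, IsCompact C ∧ ∀ x ∉ C, ‖f x‖ < ε := by
  have h1 := f.zero_at_infty' (Metric.ball_mem_nhds 0 hε)
  rw [Filter.mem_map, Filter.mem_cocompact] at h1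
  obtain ⟨C, hC, h⟩ := h1
  exact ⟨C, hC, fun x hx => by simpa using h hx⟩

/-- Comparing functional norms gives `‖z‖ * ‖ψ‖ ≤ c * ‖ψ‖`, and `‖ψ‖` cancels. The exact constant
`c` is obtained without an approximate unit. -/
theorem norm_le_of_forall_mul_eq {E : Type*} [NormedAddCommGroup E] [NormedSpace ℂ E]
    (ψ : E →ₗ[ℂ] ℂ) (hψ : ∀ u, ‖ψ u‖ ≤ ‖u‖) (hne : ∃ u, ψ u ≠ 0) {c : ℝ} (hc : 0 ≤ c) {T : E → E}
    (hT : ∀ u, ‖T u‖ ≤ c * ‖u‖) {z : ℂ} (h : ∀ u, z * ψ u = ψ (T u)) : ‖z‖ ≤ c := by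
  set Ψ : E →L[ℂ] ℂ := ψ.mkContinuous 1 (by simpa using hψ)
  have hΨ : ∀ u, Ψ u = ψ u := fun _ => rfl
  have hpos : 0 < ‖Ψ‖ := by
    rw [norm_pos_iff]
    rintro h0
    obtain ⟨u, hu⟩ := hne
    exact hu (by rw [← hΨ, h0]; rfl)
  have key : ‖z • Ψ‖ ≤ c * ‖Ψ‖ := by
    refine ContinuousLinearMap.opNorm_le_bound _ (by positivity) fun u => ?_
    rw [smul_apply, hΨ, smul_eq_mul, h, ← hΨ]
    calc _ ≤ ‖Ψ‖ * ‖T u‖ := Ψ.le_opNorm _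
      _ ≤ ‖Ψ‖ * (c * ‖u‖) := by gcongr; exact hT u
      _ = _ := by ring
  rw [norm_smul] at key
  exact le_of_mul_le_mul_right key hpos

namespace CosetGrading

variable {G : Type u} [Group G] [TopologicalSpace G] [IsTopologicalGroup G] [LocallyCompactSpace G]
  {ℒ : SubSemilattice (ClosedSubgroup G)} {𝔄 : Type v} [NonUnitalCStarAlgebra 𝔄]
  (S : CosetGrading ℒ 𝔄)

theorem not_compactSpace_of_injective {φ : 𝔄 →⋆ₙₐ[ℂ] (G →ᵇ ℂ)} {S : CosetGrading ℒ 𝔄}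
    (hφ : S.IsNatural φ) (hinj : Function.Injective φ) {H K : ℒ} (hKH : K ≤ H) (hne : H ≠ K) :
    ¬ CompactSpace (H.1.toSubgroup ⧸ K.1.toSubgroup.subgroupOf H.1.toSubgroup) := by
  intro hc
  obtain ⟨f, hf, -⟩ := exists_zeroAtInfty_eq_one
    (isCompact_singleton (x := ((1 : G) : G ⧸ H.1.toSubgroup)))
  obtain ⟨k, hk⟩ := exists_cosetPullback_eq_toBCF
    (show K.1.toSubgroup ≤ H.1.toSubgroup from hKH) hc f
  have h1 : S.incl H f = S.incl K k := by
    apply hinj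
    rw [hφ.apply_incl, hφ.apply_incl]
    ext x
    exact DFunLike.congr_fun hk (x : G ⧸ K.1.toSubgroup)
  have h2 := (Submodule.disjoint_def.1 (S.isGraded.independent.pairwiseDisjoint hne))
    (S.incl H f) (S.incl_mem H f) (by rw [h1]; exact S.incl_mem K k)
  have h3 := S.incl_injective H (h2.trans (map_zero _).symm)
  have h4 := hf _ rfl
  rw [h3] at h4
  exact zero_ne_one h4

-- Replacing `g` by `g * k` with `k ∈ K` leaves the terms with `K ≤ H` unchanged, while a suitable
-- `k` makes all the others small.
open Classical in
theorem _root_.norm_sum_filter_le_of_not_compactSpace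
    (hℒ : ∀ H ∈ ℒ.carrier, ∀ K ∈ ℒ.carrier, ClosedOpenProduct H.toSubgroup K.toSubgroup)
    (hnc : ∀ H ∈ ℒ.carrier, ∀ K ∈ ℒ.carrier, K ≤ H → H ≠ K →
      ¬ CompactSpace (H.toSubgroup ⧸ K.toSubgroup.subgroupOf H.toSubgroup))
    (F : Finset ℒ) (f : ∀ H : ℒ, C₀(G ⧸ H.1.toSubgroup, ℂ)) (K : ℒ) (g : G) :
    ‖∑ H ∈ F with K ≤ H, f H (g : G ⧸ H.1.toSubgroup)‖ ≤
      ‖∑ H ∈ F, groupPullback H.1.toSubgroup (f H)‖ := by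
  refine le_of_forall_pos_le_add fun ε hε => ?_
  -- At most `F.card` terms are bounded by `δ`; the `+ 1` covers empty `F`.
  have hδ : 0 < ε / (F.card + 1) := by positivity
  set δ := ε / (F.card + 1) with hδdef
  obtain ⟨k, hk, hkF⟩ : ∃ k ∈ K.1.toSubgroup, ∀ H ∈ F, ¬ K ≤ H →
      ‖f H ((g * k : G) : G ⧸ H.1.toSubgroup)‖ < δ := by
    -- Otherwise `K` is covered by finitely many compact sets times subgroups `H` not containing
    -- `K`. By the covering lemma one `H` suffices, so `K ⧸ (K ⊓ H)` is compact although `K ⊓ H ≠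
    -- K`.
    by_contra! hcon
    have h1 : ∀ H : ℒ, ∃ T : Set G, IsCompact T ∧
        ∀ x : G, δ ≤ ‖f H (x : G ⧸ H.1.toSubgroup)‖ → x ∈ T * (H.1.toSubgroup : Set G) := by
      intro H
      obtain ⟨C, hC, hCf⟩ := (f H).exists_isCompact_norm_lt hδ
      obtain ⟨T, hT, hCT⟩ := exists_isCompact_subset_image_mk _ hC
      refine ⟨T, hT, fun x hx => ?_⟩
      obtain ⟨t, ht, htx⟩ := hCT (not_imp_comm.1 (hCf x) (not_lt.2 hx))
      exact ⟨t, ht, _, QuotientGroup.eq.1 htx, mul_inv_cancel_left _ _⟩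
    choose T hT hTf using h1
    obtain ⟨H, hH, C, hC, hKC⟩ := exists_subset_compact_mul_of_subset_iUnion
      (𝓢 := ClosedSubgroup.toSubgroup '' ℒ.carrier)
      (by rintro _ ⟨H, -, rfl⟩; exact H.isClosed')
      (by rintro _ ⟨H, hH, rfl⟩ _ ⟨K, hK, rfl⟩; exact ⟨H ⊓ K, ℒ.inf_mem H hH K hK, rfl⟩)
      (by rintro _ ⟨H, hH, rfl⟩ _ ⟨K, hK, rfl⟩; exact hℒ H hH K hK)
      (F.filter fun H => ¬ K ≤ H) (fun H => H.1.toSubgroup) (fun H _ => ⟨H.1, H.2, rfl⟩)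
      K.1.toSubgroup ⟨K.1, K.2, rfl⟩ (fun H => {g⁻¹} * T H)
      (fun H _ => isCompact_singleton.mul (hT H)) (by
        intro k hk
        obtain ⟨H, hHF, hKH, hle⟩ := hcon k hk
        obtain ⟨t, ht, h, hh, hth⟩ := hTf H _ hle
        simp only [Set.mem_iUnion]
        refine ⟨H, Finset.mem_filter.2 ⟨hHF, hKH⟩, g⁻¹ * t, Set.mul_mem_mul rfl ht, h, hh, ?_⟩
        simp only [] at hth ⊢
        rw [mul_assoc, hth, inv_mul_cancel_left])
    obtain ⟨T', hT', hsub⟩ := (hℒ K.1 K.2 H.1 H.2).exists_isCompact_inter_subset hC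
    refine hnc K.1 K.2 (K.1 ⊓ H.1) (ℒ.inf_mem _ K.2 _ H.2) inf_le_left ?_
      (compactSpace_quotient_of_subset_mul
        (inf_le_left : K.1.toSubgroup ⊓ H.1.toSubgroup ≤ K.1.toSubgroup) hT'
        fun x hx => hsub ⟨hx, hKC hx⟩)
    intro heq
    exact (Finset.mem_filter.1 hH).2 ((inf_eq_left (a := K.1) (b := H.1)).1 heq.symm)
  have hsum : (∑ H ∈ F, groupPullback H.1.toSubgroup (f H)) (g * k) =
      ∑ H ∈ F with K ≤ H, f H (g : G ⧸ H.1.toSubgroup) +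
        ∑ H ∈ F with ¬ K ≤ H, f H ((g * k : G) : G ⧸ H.1.toSubgroup) := by
    rw [BoundedContinuousFunction.sum_apply, ← Finset.sum_filter_add_sum_filter_not F (K ≤ ·)]
    congr 1
    refine Finset.sum_congr rfl fun H hH => ?_
    rw [groupPullback_apply, QuotientGroup.mk_mul_of_mem]
    exact (Finset.mem_filter.1 hH).2 hk
  rw [eq_sub_of_add_eq hsum.symm]
  refine (norm_sub_le _ _).trans (add_le_add (BoundedContinuousFunction.norm_coe_le_norm _ _) ?_)
  calc _ ≤ ∑ H ∈ F with ¬ K ≤ H, δ :=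
        norm_sum_le_of_le _ fun H hH => (hkF H (Finset.mem_filter.1 hH).1
          (Finset.mem_filter.1 hH).2).le
    _ ≤ F.card * δ := by
        rw [Finset.sum_const, nsmul_eq_mul]
        gcongr
        exact Finset.filter_subset _ _
    _ ≤ ε := by
        rw [hδdef, mul_div_assoc', div_le_iff₀ (by positivity)]
        nlinarith

/-- Elements of `A_H` act as approximate units on `A_K`: `u - f * u` can be made small. A character
killing `A_H` therefore kills `A_K`. -/
theorem exists_character_ne_zero_of_le {χ : 𝔄 →ₙₐ[ℂ] ℂ} (hχ : ∀ a, ‖χ a‖ ≤ ‖a‖) {K H : ℒ}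
    (hKH : K ≤ H) (hK : ∃ u, χ (S.incl K u) ≠ 0) : ∃ f, χ (S.incl H f) ≠ 0 := by
  by_contra! hH
  obtain ⟨u, hu⟩ := hK
  refine hu (norm_le_zero_iff.1 (le_of_forall_pos_le_add fun ε hε => ?_))
  obtain ⟨C, hC, hCu⟩ := u.exists_isCompact_norm_lt hε
  have hKH' : K.1.toSubgroup ≤ H.1.toSubgroup := hKH
  obtain ⟨f, hf, -, hf1⟩ := exists_zeroAtInfty_eq_one (hC.image (cosetProjection hKH').continuous)
  have h1 := S.incl_mul_incl_of_le hKH f u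
  have h2 : χ (S.incl K u) = χ (S.incl K (u - boundedMulZeroAtInfty (cosetPullback hKH' f) u)) := by
    rw [map_sub, map_sub, ← h1, map_mul, hH, zero_mul, sub_zero]
  rw [h2, zero_add]
  refine (hχ _).trans ?_
  rw [norm_incl, ← ZeroAtInftyContinuousMap.norm_toBCF_eq_norm,
    BoundedContinuousFunction.norm_le hε.le]
  intro x
  change ‖u x - f (cosetProjection hKH' x) * u x‖ ≤ ε
  by_cases hx : x ∈ C
  · rw [hf _ ⟨x, hx, rfl⟩, one_mul, sub_self, norm_zero]
    exact hε.le
  · rw [← one_sub_mul, norm_mul]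
    calc _ ≤ 1 * ‖u x‖ := by gcongr; exact hf1 _
      _ ≤ ε := by rw [one_mul]; exact (hCu x hx).le

-- The indices where `χ` is nonzero are stable under meets and upward closed, so those in `F` are
-- exactly the elements above their meet `K`. There the sum acts on `A_K` as a function bounded by
-- `c`.
open Classical in
theorem norm_character_sum_le {χ : 𝔄 →ₙₐ[ℂ] ℂ} (hχ : ∀ a, ‖χ a‖ ≤ ‖a‖) (F : Finset ℒ)
    (f : ∀ H : ℒ, C₀(G ⧸ H.1.toSubgroup, ℂ)) {c : ℝ} (hc : 0 ≤ c)
    (h : ∀ (K : ℒ) (g : G), ‖∑ H ∈ F with K ≤ H, f H (g : G ⧸ H.1.toSubgroup)‖ ≤ c) :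
    ‖χ (∑ H ∈ F, S.incl H (f H))‖ ≤ c := by
  set F' := F.filter fun H => ∃ f, χ (S.incl H f) ≠ 0 with hF'
  have hsum : χ (∑ H ∈ F, S.incl H (f H)) = χ (∑ H ∈ F', S.incl H (f H)) := by
    rw [map_sum, map_sum, hF', Finset.sum_filter_of_ne]
    exact fun H _ hH => ⟨f H, hH⟩
  rw [hsum]
  obtain hemp | hne := F'.eq_empty_or_nonempty
  · rw [hemp, Finset.sum_empty, map_zero, norm_zero]
    exact hc
  set K := F'.inf' hne id with hK
  have hKχ : ∃ u, χ (S.incl K u) ≠ 0 := by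
    refine Finset.inf'_induction hne id (p := fun H => ∃ u, χ (S.incl H u) ≠ 0) ?_
      fun H hH => (Finset.mem_filter.1 hH).2
    rintro H ⟨a, ha⟩ L ⟨b, hb⟩
    obtain ⟨k, hk, -⟩ := S.incl_mul_incl a b
    exact ⟨k, by rw [← hk, map_mul]; exact mul_ne_zero ha hb⟩
  have hFK : F' = F.filter fun H => K ≤ H := by
    refine Finset.filter_congr fun H hH => ⟨fun hf => ?_, fun hKH =>
      S.exists_character_ne_zero_of_le hχ hKH hKχ⟩
    exact Finset.inf'_le id (Finset.mem_filter.2 ⟨hH, hf⟩)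
  obtain ⟨y, hy, hyu⟩ := S.exists_sum_incl_mul K F' (fun H hH => Finset.inf'_le id hH) f
  have hyc : ‖y‖ ≤ c := by
    rw [BoundedContinuousFunction.norm_le hc]
    intro x
    obtain ⟨g, rfl⟩ := QuotientGroup.mk_surjective x
    rw [hy, hFK]
    exact h K g
  generalize ∑ H ∈ F', S.incl H (f H) = x at hyu
  refine norm_le_of_forall_mul_eq ((χ : 𝔄 →ₗ[ℂ] ℂ) ∘ₗ S.inclLinear K)
    (fun u => (hχ _).trans_eq (S.norm_incl K u)) hKχ hc (T := boundedMulZeroAtInfty y)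
    (fun u => (norm_boundedMulZeroAtInfty_le y u).trans (by gcongr)) fun u => ?_
  exact (map_mul χ x _).symm.trans (congrArg χ (hyu u))

open scoped CStarAlgebra in
theorem injective_of_not_compactSpace {φ : 𝔄 →⋆ₙₐ[ℂ] (G →ᵇ ℂ)} {S : CosetGrading ℒ 𝔄}
    (hφ : S.IsNatural φ)
    (hℒ : ∀ H ∈ ℒ.carrier, ∀ K ∈ ℒ.carrier, ClosedOpenProduct H.toSubgroup K.toSubgroup)
    (hnc : ∀ H ∈ ℒ.carrier, ∀ K ∈ ℒ.carrier, K ≤ H → H ≠ K →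
      ¬ CompactSpace (H.toSubgroup ⧸ K.toSubgroup.subgroupOf H.toSubgroup)) :
    Function.Injective φ := by
  classical
  -- The inequality is a closed condition, so finite sums suffice.
  have hbound : ∀ x, ‖x‖ ≤ ‖φ x‖ := by
    intro x
    refine S.dense_sum_incl.induction ?_
      (isClosed_le continuous_norm (map_continuous φ).norm) x
    rintro _ ⟨F, f, rfl⟩
    refine norm_le_of_forall_character S.mul_comm (norm_nonneg _) fun χ hχ => ?_
    rw [map_sum φ]
    simp_rw [hφ.apply_incl]
    exact S.norm_character_sum_le hχ _ _ (norm_nonneg _)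
      (norm_sum_filter_le_of_not_compactSpace hℒ hnc _ _)
  rw [injective_iff_map_eq_zero]
  intro x hx
  simpa [hx] using hbound x

end CosetGrading

theorem proposition6p1p3 {G : Type u} [Group G] [TopologicalSpace G] [IsTopologicalGroup G]
    [LocallyCompactSpace G] [T2Space G] :
    -- equivalent conditions on a pair of closed subgroups
    (∀ H K : ClosedSubgroup G,
      List.TFAE [
        ∀ (f : C₀(G ⧸ H.toSubgroup, ℂ)) (g : C₀(G ⧸ K.toSubgroup, ℂ)),
          ∃ k : C₀(G ⧸ (H.toSubgroup ⊓ K.toSubgroup), ℂ),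
            cosetPullback (inf_le_left : H.toSubgroup ⊓ K.toSubgroup ≤ H.toSubgroup) f *
              cosetPullback (inf_le_right : H.toSubgroup ⊓ K.toSubgroup ≤ K.toSubgroup) g =
                k.toBCF,
        IsClosedMap fun x : G ⧸ (H.toSubgroup ⊓ K.toSubgroup) =>
          (cosetProjection (inf_le_left : H.toSubgroup ⊓ K.toSubgroup ≤ H.toSubgroup) x,
            cosetProjection (inf_le_right : H.toSubgroup ⊓ K.toSubgroup ≤ K.toSubgroup) x),
        ClosedOpenProduct H.toSubgroup K.toSubgroup,
        ClosedOpenImage H.toSubgroup K.toSubgroup,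
        ClosedOpenImage K.toSubgroup H.toSubgroup]) ∧
    ∀ ℒ : SubSemilattice (ClosedSubgroup G),
      (∀ H ∈ ℒ.carrier, ∀ K ∈ ℒ.carrier, ClosedOpenProduct H.toSubgroup K.toSubgroup) →
      -- the graded C⋆-algebra exists
      (∃ (𝔄 : Type u) (_ : NonUnitalCStarAlgebra 𝔄), Nonempty (CosetGrading ℒ 𝔄)) ∧
      -- the natural homomorphism exists, is unique, and is injective exactly as claimed
      ∀ (𝔄 : Type v) [NonUnitalCStarAlgebra 𝔄] (S : CosetGrading ℒ 𝔄),
        (∃! φ : 𝔄 →⋆ₙₐ[ℂ] (G →ᵇ ℂ), S.IsNatural φ) ∧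
        ∀ φ : 𝔄 →⋆ₙₐ[ℂ] (G →ᵇ ℂ), S.IsNatural φ →
          (Function.Injective φ ↔
            ∀ H ∈ ℒ.carrier, ∀ K ∈ ℒ.carrier, K ≤ H → H ≠ K →
              ¬ CompactSpace (H.toSubgroup ⧸ K.toSubgroup.subgroupOf H.toSubgroup)) := by
  refine ⟨fun H K => tfae_closedOpenProduct H.toSubgroup K.toSubgroup, fun ℒ hℒ =>
    ⟨exists_cosetGrading hℒ, fun 𝔄 _ S => ⟨?_, fun φ hφ => ⟨fun hinj H hH K hK hKH hne => ?_,
      CosetGrading.injective_of_not_compactSpace hφ hℒ⟩⟩⟩⟩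
  · obtain ⟨φ, hφ⟩ := S.exists_isNatural
    exact ⟨φ, hφ, fun φ' hφ' => hφ'.unique hφ⟩
  · exact CosetGrading.not_compactSpace_of_injective (H := ⟨H, hH⟩) (K := ⟨K, hK⟩) hφ hinj hKH
      fun h => hne (congrArg Subtype.val h)
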